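/- Let $\mathbb F$ be a field and let $T\subseteq\mathbb R$ be an additive subgroup with the order of $\mathbb R$ (for instance $T=\mathbb Z$). A persistence module is a functor $V$ from the ordered set $T$ to $\mathbb F$-vector spaces with inner morphisms $v_{s,t}\colon V_s\to V_t$ ($s\le t$). We assume that all $V_t$ are finite dimensional and that $V$ is finitely indexed: there is a finite set $S\subset T$ such that $V_t=0$ unless $\min S\le t\le\max S$, $v_{s,t}$ is injective whenever $S\cap[s,t)=\emptyset$, and $v_{s,t}$ is surjective whenever $S\cap(s,t]=\emptyset$. (A module indexed by $\{0,\dots,l\}$, extended by $0$ to $\mathbb Z$, is of this kind.) Such a $V$ is a finite direct sum of interval modules $k_{[a,b]}$ with $a\le b$ in $T$; the bars $[a,b]$, of length $b-a$, form its barcode. A *barcode basis* of $V$ is a choice of a basis of every $V_t$ that corresponds to such a decomposition; the vectors belonging to one summand $k_J$ form a *generator* of the bar $J$. The *nestedness* of $V$ is $$\Xi(V)=\min\bigl\{\min\{|a-c|,|b-d|\} : [a,b],[c,d]\text{ bars of }V,\ c<a,\ b<d\bigr\}\in(0,\infty],$$ with $\min\emptyset=\infty$. For $\delta\in T$ the shift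 $V(\delta)$ is given by $V(\delta)_t=V_{t+\delta}$, and $[\delta]\colon V\to V(\delta)$ (for $\delta\ge0$) denotes the family of inner morphisms $v_{t,t+\delta}$. For $\delta \ge 0$, a $\delta$-*interleaving pair* is a pair of morphisms $\Phi\colon V\to W(\delta)$, $\Psi\colon W\to V(\delta)$ with $\Psi(\delta)\circ\Phi=[2\delta]$ and $\Phi(\delta)\circ\Psi=[2\delta]$. For $q\ge0$ a $q$-*splitting* of $V$ is an isomorphism $V\cong V_{\ge q}\oplus V_{<q}$ where all bars of $V_{\ge q}$ have length at least $q$ and all bars of $V_{<q}$ have length less than $q$; it gives a projection $pr^V_{\ge q}\colon V\to V_{\ge q}$ and an inclusion $i^V_{\ge q}\colon V_{\ge q}\to V$. If $q/2\in T$, put $$\varphi^V_{\ge q}=[\tfrac q2]\circ pr^V_{\ge q}\colon V\to V_{\ge q}(\tfrac q2),\qquad \tilde\varphi^V_{\ge q}=i^V_{\ge q}(\tfrac q2)\circ[\tfrac q2]\colon V_{\ge q}\to V(\tfrac q2).$$ For bars write $[i_1,j_1]\preceq[i_2,j_2]$ if $i_1\le i_2\le j_1\le j_2$. A morphism $\Theta\colon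 X\to Y$ *decomposes as a ladder module* if $(X,Y,\Theta)$ is isomorphic to a finite direct sum of the elementary ladder modules $\mathbf R_{J}^{K}=(k_K\to k_J)$ for $J\preceq K$ (generator to generator), $\mathbf I^+_J=(k_J\to0)$ and $\mathbf I^-_K=(0\to k_K)$. The decomposition is *obtained in* barcode bases of $X$ and $Y$ if the isomorphism carries their generators bijectively to the generators of the source sides, respectively target sides, of the elementary summands. **Theorem.** Let $V,W$ be finitely indexed pointwise finite dimensional persistence modules, let $\delta\in T$, $\delta\ge0$, and let $\Phi\colon V\to W(\delta)$ be a morphism that is part of a $\delta$-interleaving pair. Let $q\ge0$ with $q/2\in T$, and fix $q$-splittings of $V$ and $W$. 1. If $\delta<\frac12\min(\Xi(V),\Xi(W_{\ge q}))-\frac q2$, then $\varphi^W_{\ge q}(\delta)\circ\Phi\colon V\to W_{\ge q}(\delta+\frac q2)$ decomposes as a ladder module. 2. If $\delta<\frac12\min(\Xi(V_{\ge q}),\Xi(W))-\frac q2$, then $\Phi(\frac q2)\circ\tilde\varphi^V_{\ge q}\colon V_{\ge q}\to W(\delta+\frac q2)$ decomposes as a ladder module. 3. If $\delta<\frac12\min(\Xi(V_{\ge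 q}),\Xi(W_{\ge q}))-\frac q2$, then $\tilde\Phi=\varphi^W_{\ge q}(\delta)\circ\Phi\circ i^V_{\ge q}\colon V_{\ge q}\to W_{\ge q}(\delta+\frac q2)$ decomposes as a ladder module. Moreover, in each case there is such a decomposition that is obtained in a barcode basis of the source ($V$ or $V_{\ge q}$) and the shift of a barcode basis of $W$ or $W_{\ge q}$, and these bases extend (via $i^V_{\ge q}$ and $i^W_{\ge q}$ where the $q$-coarse part occurs) to barcode bases of $V$ and $W$. -/

import Mathlib

universe u v w x

/-- A persistence module over the field `F`, indexed by the additive subgroup `T` of `ℝ` (with the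
order of `ℝ`): a functor from the totally ordered set `T` to `F`-vector spaces. A module indexed by
`{0, …, l}` is regarded as a module over the integers `T = ℤ ⊆ ℝ` that is zero outside `{0, …, l}`. -/
structure PersistenceModule (F : Type u) [Field F] (T : AddSubgroup ℝ) where
  obj : T → Type v
  [addCommGroup : ∀ t, AddCommGroup (obj t)]
  [module : ∀ t, Module F (obj t)]
  map : ∀ {s t : T}, s ≤ t → obj s →ₗ[F] obj t
  map_refl : ∀ (t : T) (y : obj t), map (le_refl t) y = y
  map_map : ∀ {r s t : T} (hrs : r ≤ s) (hst : s ≤ t) (y : obj r),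
    map hst (map hrs y) = map (hrs.trans hst) y

attribute [instance] PersistenceModule.addCommGroup PersistenceModule.module

namespace PersistenceModule

variable {F : Type u} [Field F] {T : AddSubgroup ℝ}

/-- The module is pointwise finite dimensional and there is a finite set `S` of critical times such
that the module vanishes outside the span of `S`, classes die only immediately after a time in `S`,
and classes are born only at a time in `S`. Thus all bars are closed intervals `[a, b]` with
`a, b ∈ S`. For `T = ℤ` these are exactly the pointwise finite dimensional modules that vanish
outside a finite set of indices. -/
def IsFinitelyIndexed (V : PersistenceModule.{u, v} F T) : Prop :=
  (∀ t, Module.Finite F (V.obj t)) ∧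
  ∃ S : Finset T,
    (∀ t, Nontrivial (V.obj t) → ∃ a ∈ S, ∃ b ∈ S, a ≤ t ∧ t ≤ b) ∧
    (∀ (s t : T) (h : s ≤ t), (∀ c ∈ S, ¬ (s ≤ c ∧ c < t)) → Function.Injective (V.map h)) ∧
    (∀ (s t : T) (h : s ≤ t), (∀ c ∈ S, ¬ (s < c ∧ c ≤ t)) → Function.Surjective (V.map h))

/-- Morphisms of persistence modules. -/
structure Hom (V : PersistenceModule.{u, v} F T) (W : PersistenceModule.{u, w} F T) where
  app : ∀ t, V.obj t →ₗ[F] W.obj t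
  naturality : ∀ {s t : T} (h : s ≤ t) (y : V.obj s), app t (V.map h y) = W.map h (app s y)

/-- Composition: `g.comp f` is `g ∘ f`. -/
def Hom.comp {U : PersistenceModule.{u, v} F T} {V : PersistenceModule.{u, w} F T}
    {W : PersistenceModule.{u, x} F T} (g : V.Hom W) (f : U.Hom V) : U.Hom W where
  app t := (g.app t).comp (f.app t)
  naturality h y := by simp [f.naturality, g.naturality]

/-- Isomorphisms of persistence modules. -/
structure Iso (V : PersistenceModule.{u, v} F T) (W : PersistenceModule.{u, w} F T) where
  hom : V.Hom W
  inv : W.Hom V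
  inv_hom : ∀ t y, inv.app t (hom.app t y) = y
  hom_inv : ∀ t y, hom.app t (inv.app t y) = y

/-- The shift `V(δ)`, with `V(δ)_t = V_{t + δ}`. -/
def shift (V : PersistenceModule.{u, v} F T) (δ : T) : PersistenceModule.{u, v} F T where
  obj t := V.obj (t + δ)
  map h := V.map (by gcongr)
  map_refl t y := V.map_refl _ y
  map_map _ _ y := V.map_map _ _ y

/-- The shift `Φ(δ) : V(δ) → W(δ)` of a morphism `Φ : V → W`. -/
def Hom.shift {V : PersistenceModule.{u, v} F T} {W : PersistenceModule.{u, w} F T}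
    (Φ : V.Hom W) (δ : T) : (V.shift δ).Hom (W.shift δ) where
  app t := Φ.app (t + δ)
  naturality _ y := Φ.naturality _ y

/-- The family `[δ] : V → V(δ)` of inner morphisms `v_{t, t + δ}`. -/
def inner (V : PersistenceModule.{u, v} F T) {δ : T} (hδ : 0 ≤ δ) : V.Hom (V.shift δ) where
  app _ := V.map (le_add_of_nonneg_right hδ)
  naturality h y := by
    refine (V.map_map _ _ y).trans (Eq.symm (V.map_map _ _ y))

/-- `(Φ, Ψ)` is a `δ`-interleaving pair between `V` and `W`. -/
def IsInterleaving {V : PersistenceModule.{u, v} F T} {W : PersistenceModule.{u, w} F T}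
    {δ : T} (hδ : 0 ≤ δ) (Φ : V.Hom (W.shift δ)) (Ψ : W.Hom (V.shift δ)) : Prop :=
  (∀ (t : T) (y : V.obj t), Ψ.app (t + δ) (Φ.app t y) =
    V.map ((le_add_of_nonneg_right hδ).trans (le_add_of_nonneg_right hδ) : t ≤ t + δ + δ) y) ∧
  (∀ (t : T) (y : W.obj t), Φ.app (t + δ) (Ψ.app t y) =
    W.map ((le_add_of_nonneg_right hδ).trans (le_add_of_nonneg_right hδ) : t ≤ t + δ + δ) y)

variable (F T) in
/-- The zero persistence module. -/
def zero : PersistenceModule.{u, u} F T where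
  obj _ := PUnit.{u + 1}
  map _ := 0
  map_refl _ _ := rfl
  map_map _ _ _ := rfl

/-- The direct sum of two persistence modules. -/
def prod (V W : PersistenceModule.{u, v} F T) : PersistenceModule.{u, v} F T where
  obj t := V.obj t × W.obj t
  map h := (V.map h).prodMap (W.map h)
  map_refl t y := by simp [V.map_refl, W.map_refl]
  map_map h h' y := by simp [V.map_map, W.map_map]

/-- The direct sum of a family of persistence modules. -/
noncomputable def directSum {κ : Type} (M : κ → PersistenceModule.{u, v} F T) :
    PersistenceModule.{u, v} F T where
  obj t := DirectSum κ fun k => (M k).obj t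
  map h := DirectSum.lmap fun k => (M k).map h
  map_refl t y := by
    refine DFinsupp.ext fun k => ?_
    exact (M k).map_refl t _
  map_map h h' y := by
    refine DFinsupp.ext fun k => ?_
    exact (M k).map_map h h' _

end PersistenceModule

/-- A bar: a nonempty closed interval `[birth, death]` in `T`. -/
structure Bar (T : AddSubgroup ℝ) where
  birth : T
  death : T
  birth_le_death : birth ≤ death

namespace Bar

variable {T : AddSubgroup ℝ}

/-- `t` lies in the bar. -/
def Mem (J : Bar T) (t : T) : Prop := J.birth ≤ t ∧ t ≤ J.death

/-- The length `b - a` of the bar `[a, b]`. -/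
def length (J : Bar T) : ℝ := (J.death : ℝ) - (J.birth : ℝ)

/-- The overlapping relation `J ≼ K`: `[i₁, j₁] ≼ [i₂, j₂]` iff `i₁ ≤ i₂ ≤ j₁ ≤ j₂`. -/
def Overlaps (J K : Bar T) : Prop :=
  J.birth ≤ K.birth ∧ K.birth ≤ J.death ∧ J.death ≤ K.death

/-- `J` is strictly nested in `K`: both endpoints of `J` lie strictly inside `K`. -/
def StrictlyNested (J K : Bar T) : Prop := K.birth < J.birth ∧ J.death < K.death

/-- The shifted bar `[a, b](δ) = [a - δ, b - δ]`. -/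
def shift (J : Bar T) (δ : T) : Bar T where
  birth := J.birth - δ
  death := J.death - δ
  birth_le_death := sub_le_sub_right J.birth_le_death δ

theorem mem_shift (J : Bar T) (δ t : T) : (J.shift δ).Mem t ↔ J.Mem (t + δ) := by
  simp [Mem, shift, le_sub_iff_add_le]

end Bar

namespace PersistenceModule

variable {F : Type u} [Field F] {T : AddSubgroup ℝ}

/-- A barcode basis of `V`, given by its finite family of bar generators: the basis of `V_t` consists
of one vector for each generator `i` whose bar contains `t`, and the inner morphisms send the vector
of the generator `i` to the vector of the same generator while its bar lasts, and to `0` after that.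
(Listing the generators in order of birth puts the matrices of the inner morphisms into barcode
form.) Such a family is the same as an isomorphism of `V` with a finite direct sum of interval
modules. -/
structure BarcodeBasis (V : PersistenceModule.{u, v} F T) where
  ι : Type
  [fintype : Fintype ι]
  bar : ι → Bar T
  basis : ∀ t, Module.Basis {i : ι // (bar i).Mem t} F (V.obj t)
  map_basis_of_mem : ∀ {s t : T} (h : s ≤ t) (i : ι) (hs : (bar i).Mem s) (ht : (bar i).Mem t),
    V.map h (basis s ⟨i, hs⟩) = basis t ⟨i, ht⟩
  map_basis_of_not_mem : ∀ {s t : T} (h : s ≤ t) (i : ι) (hs : (bar i).Mem s),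
    ¬ (bar i).Mem t → V.map h (basis s ⟨i, hs⟩) = 0

attribute [instance] BarcodeBasis.fintype

open Classical in
/-- The component at time `t` of the generator `i`; it is `0` when the bar does not contain `t`. -/
noncomputable def BarcodeBasis.gen {V : PersistenceModule.{u, v} F T} (B : V.BarcodeBasis)
    (i : B.ι) (t : T) : V.obj t :=
  if h : (B.bar i).Mem t then B.basis t ⟨i, h⟩ else 0

/-- The barcode basis of `V(δ)` given by a barcode basis of `V`. -/
noncomputable def BarcodeBasis.shift {V : PersistenceModule.{u, v} F T} (B : V.BarcodeBasis)
    (δ : T) : (V.shift δ).BarcodeBasis where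
  ι := B.ι
  bar i := (B.bar i).shift δ
  basis t := (B.basis (t + δ)).reindex
    (Equiv.subtypeEquivRight fun i => ((B.bar i).mem_shift δ t).symm)
  map_basis_of_mem {s t} h i hs ht := by
    refine (congrArg (V.map _) ((B.basis (s + δ)).reindex_apply _ _)).trans
      (Eq.trans ?_ ((B.basis (t + δ)).reindex_apply _ _).symm)
    exact B.map_basis_of_mem (add_le_add_left h δ) i _ _
  map_basis_of_not_mem {s t} h i hs ht := by
    refine (congrArg (V.map _) ((B.basis (s + δ)).reindex_apply _ _)).trans ?_
    exact B.map_basis_of_not_mem (add_le_add_left h δ) i _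
      (fun h' => ht (((B.bar i).mem_shift δ t).2 h'))

/-- `j : U → V` carries the barcode basis `B` of `U` into a barcode basis of `V`: there is a barcode
basis of `V` that contains the images under `j` of all generators in `B`, with the same bars. -/
def BarcodeBasis.ExtendsAlong {U V : PersistenceModule.{u, v} F T} (B : U.BarcodeBasis)
    (j : U.Hom V) : Prop :=
  ∃ (C : V.BarcodeBasis) (f : B.ι → C.ι), Function.Injective f ∧
    (∀ i, C.bar (f i) = B.bar i) ∧ ∀ i t, j.app t (B.gen i t) = C.gen (f i) t

/-- The bar `J` belongs to the barcode of `V`, that is, the interval module of `J` appears in the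
interval decomposition of `V`. -/
def IsBar (V : PersistenceModule.{u, v} F T) (J : Bar T) : Prop :=
  ∃ (B : V.BarcodeBasis) (i : B.ι), B.bar i = J

/-- The nestedness `Ξ(V)`: the minimum over all pairs `[a, b] ⊂ [c, d]` of strictly nested bars of
`V` of `min {|a - c|, |b - d|}`, and `∞` if there are no such pairs. -/
noncomputable def nestedness (V : PersistenceModule.{u, v} F T) : EReal :=
  ⨅ (J : Bar T) (K : Bar T) (_ : V.IsBar J ∧ V.IsBar K ∧ J.StrictlyNested K),
    ((min |(J.birth : ℝ) - K.birth| |(J.death : ℝ) - K.death| : ℝ) : EReal)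

/-- A `q`-splitting `V ≅ V_{≥ q} ⊕ V_{< q}`. -/
structure QSplitting (V : PersistenceModule.{u, v} F T) (q : ℝ) where
  coarse : PersistenceModule.{u, v} F T
  fine : PersistenceModule.{u, v} F T
  iso : V.Iso (coarse.prod fine)
  le_length : ∀ J, coarse.IsBar J → q ≤ J.length
  length_lt : ∀ J, fine.IsBar J → J.length < q

namespace QSplitting

variable {V : PersistenceModule.{u, v} F T} {q : ℝ}

/-- The projection `pr_{≥ q} : V → V_{≥ q}`. -/
def pr (S : QSplitting V q) : V.Hom S.coarse :=
  Hom.comp (V := S.coarse.prod S.fine)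
    { app := fun t => LinearMap.fst F (S.coarse.obj t) (S.fine.obj t)
      naturality := fun _ _ => rfl } S.iso.hom

/-- The inclusion `i_{≥ q} : V_{≥ q} → V`. -/
def incl (S : QSplitting V q) : S.coarse.Hom V :=
  Hom.comp (V := S.coarse.prod S.fine) S.iso.inv
    { app := fun t => LinearMap.inl F (S.coarse.obj t) (S.fine.obj t)
      naturality := fun h _ =>
        Prod.ext rfl (((S.fine.map h).map_zero).symm) }

/-- The morphism `φ_{≥ q} = [q/2] ∘ pr_{≥ q} : V → V_{≥ q}(q/2)`. -/
def toCoarse (S : QSplitting V q) {κ : T} (hκ : 0 ≤ κ) (_ : (κ : ℝ) = q / 2) :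
    V.Hom (S.coarse.shift κ) :=
  (S.coarse.inner hκ).comp S.pr

/-- The morphism `φ̃_{≥ q} = i_{≥ q}(q/2) ∘ [q/2] : V_{≥ q} → V(q/2)`. -/
def ofCoarse (S : QSplitting V q) {κ : T} (hκ : 0 ≤ κ) (_ : (κ : ℝ) = q / 2) :
    S.coarse.Hom (V.shift κ) :=
  (S.incl.shift κ).comp (S.coarse.inner hκ)

end QSplitting

/-! ### Interval modules and ladder modules -/

variable (F) in
/-- The value at time `t` of the interval module of the bar `J`, as a subspace of `F`: all of `F` if
`t ∈ J` and `0` otherwise. -/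
def intervalSpace (J : Bar T) (t : T) : Submodule F F where
  carrier := {y | ¬ J.Mem t → y = 0}
  add_mem' ha hb ht := by rw [ha ht, hb ht, add_zero]
  zero_mem' _ := rfl
  smul_mem' c y hy ht := by rw [hy ht, smul_zero]

open Classical in
variable (F) in
/-- The linear map from `intervalSpace F K s` to `intervalSpace F J t` induced by the identity of
`F` if `t ∈ J`, and `0` otherwise. -/
noncomputable def intervalMap (K J : Bar T) (s t : T) :
    intervalSpace F K s →ₗ[F] intervalSpace F J t where
  toFun y := ⟨if J.Mem t then (y : F) else 0, fun ht => if_neg ht⟩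
  map_add' y z := by
    apply Subtype.ext
    by_cases ht : J.Mem t <;> simp [ht]
  map_smul' c y := by
    apply Subtype.ext
    by_cases ht : J.Mem t <;> simp [ht]

theorem intervalMap_comp {I J K : Bar T} {r s t : T}
    (h : I.Mem r → K.Mem t → J.Mem s) (y : intervalSpace F I r) :
    intervalMap F J K s t (intervalMap F I J r s y) = intervalMap F I K r t y := by
  obtain ⟨y, hy⟩ := y
  apply Subtype.ext
  by_cases ht : K.Mem t
  · by_cases hs : J.Mem s
    · simp [intervalMap, hs, ht]
    · simp [intervalMap, hy (fun hr => hs (h hr ht))]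
  · simp [intervalMap, ht]

variable (F) in
/-- The interval module of the bar `J`: it is `F` at times in `J` and `0` at all other times, with
the identity of `F` as inner morphism between times in `J`. -/
noncomputable def interval (J : Bar T) : PersistenceModule.{u, u} F T where
  obj t := intervalSpace F J t
  map {s t} _ := intervalMap F J J s t
  map_refl t y := by
    obtain ⟨y, hy⟩ := y
    apply Subtype.ext
    by_cases h : J.Mem t
    · simp [intervalMap, h]
    · simp [intervalMap, hy h]
  map_map hrs hst y :=
    intervalMap_comp (fun hr ht => ⟨hr.1.trans hrs, hst.trans ht.2⟩) y

open Classical in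
variable (F) in
/-- The component at time `t` of the generator of the interval module of `J`: it is `1` if `t ∈ J`
and `0` otherwise. -/
noncomputable def intervalGen (J : Bar T) (t : T) : (interval F J).obj t :=
  (⟨if J.Mem t then 1 else 0, fun ht => if_neg ht⟩ : intervalSpace F J t)

variable (F) in
/-- For `J ≼ K`, the morphism from the interval module of `K` to the interval module of `J` that
sends generator to generator: the identity of `F` at times in `J ∩ K` and `0` elsewhere. -/
noncomputable def intervalHom {J K : Bar T} (hJK : J.Overlaps K) :
    (interval F K).Hom (interval F J) where
  app t := intervalMap F K J t t
  naturality h y :=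
    (intervalMap_comp (fun hs ht => ⟨hs.1.trans h, ht.2.trans hJK.2.2⟩) y).trans
      (intervalMap_comp (fun hs ht => ⟨hJK.1.trans hs.1, h.trans ht.2⟩) y).symm

end PersistenceModule

open PersistenceModule

/-- A ladder persistence module `(V, W, Φ)`. -/
structure LadderModule (F : Type u) [Field F] (T : AddSubgroup ℝ) where
  src : PersistenceModule.{u, v} F T
  tgt : PersistenceModule.{u, w} F T
  hom : src.Hom tgt

namespace LadderModule

variable {F : Type u} [Field F] {T : AddSubgroup ℝ}

/-- Isomorphisms of ladder persistence modules. -/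
structure Iso (L : LadderModule.{u, v, w} F T) (L' : LadderModule.{u, u, u} F T) where
  src : L.src.Iso L'.src
  tgt : L.tgt.Iso L'.tgt
  comm : ∀ t y, tgt.hom.app t (L.hom.app t y) = L'.hom.app t (src.hom.app t y)

/-- The direct sum of a family of ladder persistence modules. -/
noncomputable def directSum {κ : Type} (L : κ → LadderModule.{u, u, u} F T) :
    LadderModule.{u, u, u} F T where
  src := PersistenceModule.directSum fun k => (L k).src
  tgt := PersistenceModule.directSum fun k => (L k).tgt
  hom :=
    { app := fun t => DirectSum.lmap fun k => (L k).hom.app t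
      naturality := fun h y => by
        refine DFinsupp.ext fun k => ?_
        exact (L k).hom.naturality h _ }

end LadderModule

/-- The elementary ladder persistence modules `R_J^K` (for `J ≼ K`), `I⁺_J` and `I⁻_K`. -/
inductive LadderBlock (T : AddSubgroup ℝ) where
  | R (J K : Bar T) (h : J.Overlaps K)
  | IPlus (J : Bar T)
  | IMinus (K : Bar T)

namespace LadderBlock

variable {T : AddSubgroup ℝ}

/-- `R_J^K` has the interval `K` on the source side, the interval `J` on the target side and sends
generator to generator; `I⁺_J` has `J` on the source side and `0` on the target side; `I⁻_K` has `0`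
on the source side and `K` on the target side. -/
noncomputable def toLadder (F : Type u) [Field F] : LadderBlock T → LadderModule.{u, u, u} F T
  | R J K h => ⟨interval F K, interval F J, intervalHom F h⟩
  | IPlus J => ⟨interval F J, PersistenceModule.zero F T, ⟨fun _ => 0, fun _ _ => rfl⟩⟩
  | IMinus K => ⟨PersistenceModule.zero F T, interval F K,
      ⟨fun _ => 0, fun h _ => (((interval F K).map h).map_zero).symm⟩⟩

/-- The bar on the source side, if there is one. -/
def srcBar : LadderBlock T → Option (Bar T)
  | R _ K _ => some K
  | IPlus J => some J
  | IMinus _ => none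

/-- The bar on the target side, if there is one. -/
def tgtBar : LadderBlock T → Option (Bar T)
  | R J _ _ => some J
  | IPlus _ => none
  | IMinus K => some K

/-- The component at time `t` of the generator on the source side (`0` for `I⁻_K`). -/
noncomputable def srcGen (F : Type u) [Field F] :
    ∀ (b : LadderBlock T) (t : T), (b.toLadder F).src.obj t
  | R _ K _, t => intervalGen F K t
  | IPlus J, t => intervalGen F J t
  | IMinus _, _ => PUnit.unit

/-- The component at time `t` of the generator on the target side (`0` for `I⁺_J`). -/
noncomputable def tgtGen (F : Type u) [Field F] :
    ∀ (b : LadderBlock T) (t : T), (b.toLadder F).tgt.obj t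
  | R J _ _, t => intervalGen F J t
  | IPlus _, _ => PUnit.unit
  | IMinus K, t => intervalGen F K t

end LadderBlock

/-- A ladder decomposition of a morphism `Φ : V → W`: an isomorphism of `(V, W, Φ)` with a finite
direct sum of elementary ladder modules. (The multiplicities are the numbers of equal blocks.) -/
structure LadderDecomposition {F : Type u} [Field F] {T : AddSubgroup ℝ}
    {V : PersistenceModule.{u, v} F T} {W : PersistenceModule.{u, w} F T} (Φ : V.Hom W) where
  κ : Type
  [fintype : Fintype κ]
  [decidableEq : DecidableEq κ]
  block : κ → LadderBlock T
  iso : LadderModule.Iso ⟨V, W, Φ⟩ (LadderModule.directSum fun k => (block k).toLadder F)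

attribute [instance] LadderDecomposition.fintype LadderDecomposition.decidableEq

/-- The ladder decomposition `D` of `Φ : V → W` is obtained in the barcode bases `B` of `V` and `C`
of `W`: its isomorphism carries the generators in `B` bijectively to the generators of the bars on
the source sides of the blocks, and the generators in `C` bijectively to the generators of the bars
on the target sides. -/
def LadderDecomposition.IsObtainedIn {F : Type u} [Field F] {T : AddSubgroup ℝ}
    {V : PersistenceModule.{u, v} F T} {W : PersistenceModule.{u, w} F T} {Φ : V.Hom W}
    (D : LadderDecomposition Φ) (B : V.BarcodeBasis) (C : W.BarcodeBasis) : Prop :=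
  (∃ f : B.ι → D.κ, Function.Injective f ∧
    (∀ i, (D.block (f i)).srcBar = some (B.bar i)) ∧
    (∀ k, k ∉ Set.range f → (D.block k).srcBar = none) ∧
    ∀ i t, D.iso.src.hom.app t (B.gen i t) =
      DirectSum.of (fun k => ((D.block k).toLadder F).src.obj t) (f i)
        ((D.block (f i)).srcGen F t)) ∧
  (∃ g : C.ι → D.κ, Function.Injective g ∧
    (∀ j, (D.block (g j)).tgtBar = some (C.bar j)) ∧
    (∀ k, k ∉ Set.range g → (D.block k).tgtBar = none) ∧
    ∀ j t, D.iso.tgt.hom.app t (C.gen j t) =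
      DirectSum.of (fun k => ((D.block k).toLadder F).tgt.obj t) (g j)
        ((D.block (g j)).tgtGen F t))

/-! Put η = 2δ + q. Fine bars are shorter than q, so an inner morphism over a distance of at least q
cannot tell a vector from its coarse part. Together with the interleaving identities this shows that
each of the three maps f is invertible up to η: [η] kills the kernel of f, and [η] carries every
vector of the target into the image of f (`KerTrivial`, `CokerTrivial`). The bound on δ makes the
ends of any two strictly nested bars, within the source or within the target, differ by more than η
(`nestedGaps_of_lt`).

What remains is Gaussian elimination (`exists_matching`). In barcode bases f is a matrix independent
of time (`entry`), whose entry from a source bar K to a target bar J can be nonzero only if J ≼ K. A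
multiple of a generator of I may be added to a generator of K when I ≼ K. Two bars that meet and are
not comparable in this sense are strictly nested, so nesting is the only obstruction to clearing
rows and columns.

The pivot (`exists_pivot`) avoids it. Among the nonzero entries in columns of unmatched source
generators, take the row j of latest death, then in that row the column i of earliest death, with
ties broken by birth. If the bar of i were nested in the bar of another candidate k in row j, then
triviality of the kernel would make the image of k outlive j. If the bar of an entry l in column i
were nested in the bar of j, then triviality of the cokernel would produce a candidate in row j born
before i. Both are impossible, so row j can be cleared and the generator j replaced by the image of
i, which matches one more pair (`IsPartialMatching.exists_extend`).

Barcode bases exist by splitting off one interval at a time (`HasCriticalTimes.exists_split`), and a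
basis of a coarse part extends by any basis of the fine part. -/

namespace PersistenceModule

variable {F : Type u} [Field F] {T : AddSubgroup ℝ}

/-! ### Calculus of generators and coordinates in a barcode basis -/

namespace BarcodeBasis

variable {V : PersistenceModule.{u, v} F T} (B : V.BarcodeBasis)

open Classical in
/-- The coordinate functional of the generator `i` at time `t`; it is `0` when the bar does not
contain `t`. -/
noncomputable def coef (i : B.ι) (t : T) : V.obj t →ₗ[F] F :=
  if h : (B.bar i).Mem t then (B.basis t).coord ⟨i, h⟩ else 0

theorem gen_of_mem {i : B.ι} {t : T} (h : (B.bar i).Mem t) : B.gen i t = B.basis t ⟨i, h⟩ := by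
  simp [gen, h]

theorem gen_of_not_mem {i : B.ι} {t : T} (h : ¬ (B.bar i).Mem t) : B.gen i t = 0 := by
  simp [gen, h]

theorem coef_of_not_mem {i : B.ι} {t : T} (h : ¬ (B.bar i).Mem t) (y : V.obj t) :
    B.coef i t y = 0 := by
  simp [coef, h]

theorem coef_gen_self {i : B.ι} {t : T} (h : (B.bar i).Mem t) : B.coef i t (B.gen i t) = 1 := by
  simp [coef, gen, h]

theorem gen_ne_zero {i : B.ι} {t : T} (h : (B.bar i).Mem t) : B.gen i t ≠ 0 := fun h0 => by
  have := B.coef_gen_self h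
  simp [h0] at this

theorem coef_gen_of_ne {i k : B.ι} (hik : i ≠ k) (t : T) : B.coef i t (B.gen k t) = 0 := by
  by_cases hi : (B.bar i).Mem t
  · by_cases hk : (B.bar k).Mem t
    · simp [coef, gen, hi, hk, Ne.symm hik]
    · simp [B.gen_of_not_mem hk]
  · exact B.coef_of_not_mem hi _

/-- Linear maps out of `V_t` that agree on all generators alive at `t` are equal. -/
theorem hom_ext {M : Type*} [AddCommGroup M] [Module F M] {t : T} {f g : V.obj t →ₗ[F] M}
    (h : ∀ i, (B.bar i).Mem t → f (B.gen i t) = g (B.gen i t)) : f = g := by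
  refine (B.basis t).ext fun ⟨i, hi⟩ => ?_
  rw [← B.gen_of_mem hi]
  exact h i hi

theorem sum_coef_gen (t : T) (y : V.obj t) : ∑ i, B.coef i t y • B.gen i t = y := by
  have : ∑ i, (B.coef i t).smulRight (B.gen i t) = LinearMap.id := by
    refine B.hom_ext fun k hk => ?_
    rw [LinearMap.sum_apply, Finset.sum_eq_single k]
    · simp [B.coef_gen_self hk]
    · intro i _ hik
      simp [B.coef_gen_of_ne hik]
    · simp
  simpa using LinearMap.congr_fun this y

/-- Only the birth has to be controlled: beyond the death both sides are 0. -/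
theorem map_gen {s t : T} (h : s ≤ t) {i : B.ι} (hi : (B.bar i).birth ≤ s) :
    V.map h (B.gen i s) = B.gen i t := by
  by_cases hs : (B.bar i).Mem s
  · by_cases ht : (B.bar i).Mem t
    · rw [B.gen_of_mem hs, B.gen_of_mem ht, B.map_basis_of_mem h i hs ht]
    · rw [B.gen_of_mem hs, B.gen_of_not_mem ht, B.map_basis_of_not_mem h i hs ht]
  · rw [B.gen_of_not_mem hs, B.gen_of_not_mem fun ht => hs ⟨hi, h.trans ht.2⟩, map_zero]

theorem map_gen_of_death_lt {s t : T} (h : s ≤ t) {i : B.ι} (hi : (B.bar i).death < t) :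
    V.map h (B.gen i s) = 0 := by
  by_cases hs : (B.bar i).Mem s
  · rw [B.map_gen h hs.1, B.gen_of_not_mem fun ht => hi.not_ge ht.2]
  · rw [B.gen_of_not_mem hs, map_zero]

/-- Older generators never acquire a component along one born later, so the identity also holds if
the bar starts after `s`; both sides are then 0. -/
theorem coef_map {s t : T} (h : s ≤ t) {i : B.ι} (hi : (B.bar i).Mem t) (y : V.obj s) :
    B.coef i t (V.map h y) = B.coef i s y := by
  have : (B.coef i t).comp (V.map h) = B.coef i s := by
    refine B.hom_ext fun k hk => ?_
    rw [LinearMap.comp_apply, B.map_gen h hk.1]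
    rcases eq_or_ne i k with rfl | hik
    · rw [B.coef_gen_self hi, B.coef_gen_self hk]
    · rw [B.coef_gen_of_ne hik, B.coef_gen_of_ne hik]
  exact LinearMap.congr_fun this y

theorem apply_mem_span_range {ι M N : Type*} [AddCommGroup M] [Module F M] [AddCommGroup N]
    [Module F N] (f : M →ₗ[F] N) (g : ι → M) {y : M} (hy : y ∈ Submodule.span F (Set.range g)) :
    f y ∈ Submodule.span F (Set.range fun i => f (g i)) := by
  have h := Submodule.mem_map_of_mem (f := f) hy
  rw [Submodule.map_span, ← Set.range_comp] at h
  exact h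

/-- A barcode basis from the families of components of its generators. -/
@[reducible] noncomputable def ofGen {ι : Type} [Fintype ι] (bar : ι → Bar T) (g : ∀ (_ : ι) (t : T), V.obj t)
    (hmap : ∀ i (s t : T) (h : s ≤ t), (bar i).birth ≤ s → V.map h (g i s) = g i t)
    (hzero : ∀ i t, ¬ (bar i).Mem t → g i t = 0)
    (hli : ∀ t, LinearIndependent F fun i : {i // (bar i).Mem t} => g i t)
    (hspan : ∀ t (y : V.obj t), y ∈ Submodule.span F (Set.range fun i => g i t)) :
    V.BarcodeBasis where
  ι := ι
  bar := bar
  basis t := Module.Basis.mk (hli t) (by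
    intro y _
    refine Submodule.span_le.2 ?_ (hspan t y)
    rintro _ ⟨i, rfl⟩
    by_cases hi : (bar i).Mem t
    · exact Submodule.subset_span ⟨⟨i, hi⟩, rfl⟩
    · simp [hzero i t hi])
  map_basis_of_mem h i hs ht := by simp [hmap i _ _ h hs.1]
  map_basis_of_not_mem h i hs ht := by simp [hmap i _ _ h hs.1, hzero i _ ht]

theorem gen_ofGen {ι : Type} [Fintype ι] (bar : ι → Bar T) (g : ∀ (_ : ι) (t : T), V.obj t)
    (hmap : ∀ i (s t : T) (h : s ≤ t), (bar i).birth ≤ s → V.map h (g i s) = g i t)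
    (hzero : ∀ i t, ¬ (bar i).Mem t → g i t = 0)
    (hli : ∀ t, LinearIndependent F fun i : {i // (bar i).Mem t} => g i t)
    (hspan : ∀ t (y : V.obj t), y ∈ Submodule.span F (Set.range fun i => g i t)) (i : ι) (t : T) :
    (ofGen bar g hmap hzero hli hspan).gen i t = g i t := by
  by_cases h : (bar i).Mem t
  · exact (gen_of_mem (ofGen bar g hmap hzero hli hspan) h).trans
      (by simp [ofGen])
  · exact (gen_of_not_mem (ofGen bar g hmap hzero hli hspan) h).trans (hzero i t h).symm

theorem linearIndependent_gen (t : T) :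
    LinearIndependent F fun i : {i // (B.bar i).Mem t} => B.gen i t := by
  convert (B.basis t).linearIndependent with i
  exact B.gen_of_mem i.2

theorem mem_span_gen (t : T) (y : V.obj t) :
    y ∈ Submodule.span F (Set.range fun i => B.gen i t) := by
  rw [← B.sum_coef_gen t y]
  exact Submodule.sum_mem _ fun i _ => Submodule.smul_mem _ _ (Submodule.subset_span ⟨i, rfl⟩)

theorem gen_shift (δ : T) (i : B.ι) (t : T) : (B.shift δ).gen i t = B.gen i (t + δ) := by
  by_cases h : (B.bar i).Mem (t + δ)
  · rw [B.gen_of_mem h, (B.shift δ).gen_of_mem (((B.bar i).mem_shift δ t).2 h)]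
    exact (B.basis (t + δ)).reindex_apply _ _
  · rw [B.gen_of_not_mem h, (B.shift δ).gen_of_not_mem fun h' => h (((B.bar i).mem_shift δ t).1 h')]
    rfl

section Map

variable {W : PersistenceModule.{u, w} F T}

/-- The linear equivalence at time `t` of an isomorphism. -/
def _root_.PersistenceModule.Iso.equiv (e : V.Iso W) (t : T) : V.obj t ≃ₗ[F] W.obj t :=
  LinearEquiv.ofLinearMap (e.hom.app t) (e.inv.app t) (LinearMap.ext (e.hom_inv t))
    (LinearMap.ext (e.inv_hom t))

/-- The image of a barcode basis under an isomorphism. -/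
@[reducible] noncomputable def map (e : V.Iso W) : W.BarcodeBasis where
  ι := B.ι
  bar := B.bar
  basis t := (B.basis t).map (e.equiv t)
  map_basis_of_mem h i hs ht := by
    simp only [Module.Basis.map_apply]
    exact (e.hom.naturality h _).symm.trans (congrArg _ (B.map_basis_of_mem h i hs ht))
  map_basis_of_not_mem h i hs ht := by
    simp only [Module.Basis.map_apply]
    refine (e.hom.naturality h _).symm.trans ?_
    rw [B.map_basis_of_not_mem h i hs ht, map_zero]

theorem gen_map (e : V.Iso W) (i : B.ι) (t : T) :
    (B.map e).gen i t = e.hom.app t (B.gen i t) := by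
  by_cases h : (B.bar i).Mem t
  · rw [B.gen_of_mem h, (B.map e).gen_of_mem (i := i) h]
    exact Module.Basis.map_apply _ _ _
  · rw [B.gen_of_not_mem h, (B.map e).gen_of_not_mem (i := i) h, map_zero]

theorem coef_map_iso (e : V.Iso W) (i : B.ι) (t : T) (y : W.obj t) :
    (B.map e).coef i t y = B.coef i t (e.inv.app t y) := by
  have : (B.map e).coef i t = (B.coef i t).comp (e.inv.app t) := by
    refine (B.map e).hom_ext fun k hk => ?_
    have h1 : (B.coef i t).comp (e.inv.app t) ((B.map e).gen k t) = B.coef i t (B.gen k t) :=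
      congrArg (B.coef i t) ((congrArg _ (B.gen_map e k t)).trans (e.inv_hom t _))
    rw [h1]
    rcases eq_or_ne i k with rfl | hik
    · exact ((B.map e).coef_gen_self hk).trans (B.coef_gen_self hk).symm
    · exact ((B.map e).coef_gen_of_ne hik t).trans (B.coef_gen_of_ne hik t).symm
  exact LinearMap.congr_fun this y

end Map

/-- Every barcode basis of `V(δ)` is the shift of a barcode basis of `V`. -/
theorem exists_unshift {δ : T} (C : (V.shift δ).BarcodeBasis) :
    ∃ (D : V.BarcodeBasis) (e : D.ι ≃ C.ι), (∀ i, (D.shift δ).bar i = C.bar (e i)) ∧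
      ∀ i t, (D.shift δ).gen i t = C.gen (e i) t := by
  have hle (t : T) : t - δ + δ ≤ t := (sub_add_cancel t δ).le
  -- The times `t - δ + δ` and `t` are equal but not definitionally so; the inner morphism between
  -- them replaces a cast.
  have hbij (t : T) : Function.Bijective (V.map (hle t)) := by
    have key : ∀ (s : T) (h : s ≤ t), s = t → Function.Bijective (V.map h) := by
      rintro s h rfl
      have : (V.map h : V.obj s → V.obj s) = id := funext fun y => V.map_refl s y
      rw [this]
      exact Function.bijective_id
    exact key _ _ (sub_add_cancel t δ)
  have hmem (i : C.ι) (t : T) : ((C.bar i).shift (-δ)).Mem t ↔ (C.bar i).Mem (t - δ) := by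
    rw [Bar.mem_shift, sub_eq_add_neg]
  let g : ∀ (_ : C.ι) (t : T), V.obj t := fun i t => V.map (hle t) (C.gen i (t - δ))
  let D : V.BarcodeBasis := ofGen (fun i => (C.bar i).shift (-δ)) g
    (fun i s t h hs => by
      have h1 : s - δ ≤ t - δ := sub_le_sub_right h δ
      have h2 : (C.bar i).birth ≤ s - δ := by
        have : (C.bar i).birth - -δ ≤ s := hs
        rw [sub_neg_eq_add] at this
        exact le_sub_iff_add_le.2 this
      have h3 := C.map_gen h1 h2
      simp only [g]
      rw [← h3]
      exact (V.map_map _ _ _).trans (V.map_map _ _ _).symm)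
    (fun i t h => by
      simp only [g]
      rw [C.gen_of_not_mem fun h' => h ((hmem i t).2 h')]
      exact map_zero _)
    (fun t => by
      have h1 := (C.linearIndependent_gen (t - δ)).map' (V.map (hle t))
        (LinearMap.ker_eq_bot.2 (hbij t).1)
      exact h1.comp (Equiv.subtypeEquivRight fun i => hmem i t) (Equiv.injective _))
    (fun t y => by
      obtain ⟨z, rfl⟩ := (hbij t).2 y
      exact apply_mem_span_range (V.map (hle t)) _ (C.mem_span_gen (t - δ) z))
  refine ⟨D, Equiv.refl _, fun i => ?_, fun i t => ?_⟩
  · change ((C.bar i).shift (-δ)).shift δ = C.bar i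
    simp [Bar.shift]
  · have key : ∀ (s : T) (h : s + δ ≤ t + δ), s = t → V.map h (C.gen i s) = C.gen i t := by
      rintro s h rfl
      exact V.map_refl _ _
    exact ((D.gen_shift δ i t).trans (gen_ofGen _ _ _ _ _ _ _ _)).trans (key _ _ (add_sub_cancel_right t δ))

end BarcodeBasis

end PersistenceModule

/-! ### Existence of barcode bases -/

namespace PersistenceModule

variable {F : Type u} [Field F] {T : AddSubgroup ℝ}

/-- A barcode basis from the components of its generators and coordinate functionals. -/
theorem BarcodeBasis.exists_of_coef {V : PersistenceModule.{u, v} F T} {ι : Type} [Fintype ι]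
    (bar : ι → Bar T) (g : ∀ (_ : ι) (t : T), V.obj t) (c : ∀ (_ : ι) (t : T), V.obj t →ₗ[F] F)
    (hmap : ∀ i (s t : T) (h : s ≤ t), (bar i).birth ≤ s → V.map h (g i s) = g i t)
    (hzero : ∀ i t, ¬ (bar i).Mem t → g i t = 0)
    (hone : ∀ i t, (bar i).Mem t → c i t (g i t) = 1)
    (hne : ∀ i k t, i ≠ k → c i t (g k t) = 0)
    (hsum : ∀ t (y : V.obj t), ∑ i, c i t y • g i t = y) :
    ∃ (B : V.BarcodeBasis) (e : ι ≃ B.ι), (∀ i, B.bar (e i) = bar i) ∧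
      ∀ i t, B.gen (e i) t = g i t := by
  refine ⟨ofGen bar g hmap hzero (fun t => ?_) fun t y => ?_, Equiv.refl _, fun _ => rfl,
    fun i t => gen_ofGen ..⟩
  · refine LinearIndependent.of_pairwise_dual_eq_zero_one _ (fun i => c i t) ?_ fun i => hone i t i.2
    exact fun i k hik => hne i k t fun h => hik (Subtype.ext h)
  · rw [← hsum t y]
    exact Submodule.sum_mem _ fun i _ => Submodule.smul_mem _ _ (Submodule.subset_span ⟨i, rfl⟩)

/-- `V` is pointwise finite dimensional and finitely indexed with set of critical times `S`. -/
def HasCriticalTimes (V : PersistenceModule.{u, v} F T) (S : Finset T) : Prop :=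
  (∀ t, Module.Finite F (V.obj t)) ∧
    (∀ t, Nontrivial (V.obj t) → ∃ a ∈ S, ∃ b ∈ S, a ≤ t ∧ t ≤ b) ∧
    (∀ (s t : T) (h : s ≤ t), (∀ c ∈ S, ¬ (s ≤ c ∧ c < t)) → Function.Injective (V.map h)) ∧
    (∀ (s t : T) (h : s ≤ t), (∀ c ∈ S, ¬ (s < c ∧ c ≤ t)) → Function.Surjective (V.map h))

/-- Injectivity and surjectivity of inner morphisms pass to retracts, so a direct summand keeps the
same set `S`. This serves both the induction for barcode bases and the two parts of a splitting. -/
theorem HasCriticalTimes.of_retract {U : PersistenceModule.{u, v} F T}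
    {V : PersistenceModule.{u, w} F T} {S : Finset T} (hV : V.HasCriticalTimes S)
    (i : U.Hom V) (p : V.Hom U) (hpi : ∀ t y, p.app t (i.app t y) = y) :
    U.HasCriticalTimes S := by
  have hi (t : T) : Function.Injective (i.app t) := Function.LeftInverse.injective (hpi t)
  have hp (t : T) : Function.Surjective (p.app t) := Function.RightInverse.surjective (hpi t)
  obtain ⟨h1, h2, h3, h4⟩ := hV
  refine ⟨fun t => ?_, fun t ht => ?_, fun s t h hc => ?_, fun s t h hc y => ?_⟩
  · have := h1 t
    exact Module.Finite.of_surjective (p.app t) (hp t)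
  · exact h2 t (hi t).nontrivial
  · intro y z hyz
    refine hi s (h3 s t h hc ?_)
    rw [← i.naturality, ← i.naturality, hyz]
  · obtain ⟨z, hz⟩ := h4 s t h hc (i.app t y)
    exact ⟨p.app s z, by rw [← p.naturality, hz, hpi]⟩

/-- The kernel of a family of functionals whose kernels are preserved by the inner morphisms. -/
def kerModule (V : PersistenceModule.{u, v} F T) (l : ∀ t, V.obj t →ₗ[F] F)
    (hl : ∀ (s t : T) (h : s ≤ t) (y : V.obj s), l s y = 0 → l t (V.map h y) = 0) :
    PersistenceModule.{u, v} F T where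
  obj t := LinearMap.ker (l t)
  map {s t} h := (V.map h).restrict fun y hy => hl s t h y hy
  map_refl t y := Subtype.ext (V.map_refl t y)
  map_map hrs hst y := Subtype.ext (V.map_map hrs hst y)

namespace HasCriticalTimes

variable {V : PersistenceModule.{u, v} F T} {S : Finset T}

/-- For the last critical time `c ≤ t` no critical time lies in `(c, t]`, so the inner morphism from
`c` to `t` is onto. -/
theorem exists_le_of_nontrivial (hV : V.HasCriticalTimes S) {t : T} (y : V.obj t) (hy : y ≠ 0) :
    ∃ c ∈ S, ∃ h : c ≤ t, ∃ z, V.map h z = y := by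
  obtain ⟨-, h2, -, h4⟩ := hV
  obtain ⟨a, ha, -, -, hat, -⟩ := h2 t (nontrivial_of_ne y 0 hy)
  obtain ⟨c, hc, hmax⟩ := (S.filter (· ≤ t)).exists_max_image id ⟨a, by simp [ha, hat]⟩
  simp only [Finset.mem_filter, id] at hc hmax
  obtain ⟨z, hz⟩ := h4 c t hc.2 (fun d hd hcd => (hmax d ⟨hd, hcd.2⟩).not_gt hcd.1) y
  exact ⟨c, hc.1, hc.2, z, hz⟩

/-- Dually, for the first critical time `c ≥ t` no critical time lies in `[t, c)`, so the inner
morphism is injective. -/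
theorem exists_ge_of_ne_zero (hV : V.HasCriticalTimes S) {t : T} (y : V.obj t) (hy : y ≠ 0) :
    ∃ c ∈ S, ∃ h : t ≤ c, V.map h y ≠ 0 := by
  obtain ⟨-, h2, h3, -⟩ := hV
  obtain ⟨-, -, b, hb, -, htb⟩ := h2 t (nontrivial_of_ne y 0 hy)
  obtain ⟨c, hc, hmin⟩ := (S.filter (t ≤ ·)).exists_min_image id ⟨b, by simp [hb, htb]⟩
  simp only [Finset.mem_filter, id] at hc hmin
  refine ⟨c, hc.1, hc.2, fun h0 => hy ?_⟩
  refine h3 t c hc.2 (fun d hd hcd => (hmin d ⟨hd, hcd.1⟩).not_gt hcd.2) ?_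
  rw [h0, map_zero]

/-- A nonzero element at the earliest time of a nonzero module. -/
theorem exists_earliest (hV : V.HasCriticalTimes S) {t : T} (y : V.obj t) (hy : y ≠ 0) :
    ∃ a ∈ S, (∃ z : V.obj a, z ≠ 0) ∧ ∀ s < a, Subsingleton (V.obj s) := by
  have hex (s : T) (w : V.obj s) (hw : w ≠ 0) : ∃ c ∈ S, c ≤ s ∧ ∃ z : V.obj c, z ≠ 0 := by
    obtain ⟨c, hc, hcs, z, rfl⟩ := hV.exists_le_of_nontrivial w hw
    exact ⟨c, hc, hcs, z, fun h => hw (by rw [h, map_zero])⟩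
  classical
  obtain ⟨c, hc, -, hz⟩ := hex t y hy
  obtain ⟨a, ha, hmin⟩ :=
    (S.filter fun c => ∃ z : V.obj c, z ≠ 0).exists_min_image id ⟨c, by simpa [hc] using hz⟩
  simp only [Finset.mem_filter, id] at ha hmin
  refine ⟨a, ha.1, ha.2, fun s hs => not_nontrivial_iff_subsingleton.1 fun hn => ?_⟩
  obtain ⟨w, hw⟩ := exists_ne (0 : V.obj s)
  obtain ⟨d, hd, hds, hz'⟩ := hex s w hw
  exact (hmin d ⟨hd, hz'⟩).not_gt (hds.trans_lt hs)

/-- The last time at which an element is alive. -/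
theorem exists_death (hV : V.HasCriticalTimes S) {a : T} (z : V.obj a) (hz : z ≠ 0) :
    ∃ (b : T) (h : a ≤ b), V.map h z ≠ 0 ∧ ∀ (t : T) (h' : a ≤ t), b < t → V.map h' z = 0 := by
  classical
  obtain ⟨c, hc, hac, hcz⟩ := hV.exists_ge_of_ne_zero z hz
  obtain ⟨b, hb, hmax⟩ :=
    (S.filter fun c => ∃ h : a ≤ c, V.map h z ≠ 0).exists_max_image id
      ⟨c, by simpa [hc, hac] using hcz⟩
  simp only [Finset.mem_filter, id] at hb hmax
  obtain ⟨-, hab, hbz⟩ := hb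
  refine ⟨b, hab, hbz, fun t hat hbt => by_contra fun h => ?_⟩
  obtain ⟨d, hd, htd, hdz⟩ := hV.exists_ge_of_ne_zero _ h
  rw [V.map_map] at hdz
  exact (hmax d ⟨hd, _, hdz⟩).not_gt (hbt.trans_le htd)

/-- A nonzero finitely indexed module splits off an interval summand. -/
theorem exists_split (hV : V.HasCriticalTimes S) {t₀ : T} (y₀ : V.obj t₀) (hy₀ : y₀ ≠ 0) :
    ∃ (J : Bar T) (_ : J.birth ∈ S) (g : ∀ t, V.obj t) (l : ∀ t, V.obj t →ₗ[F] F)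
      (U : PersistenceModule.{u, v} F T) (i : U.Hom V) (p : V.Hom U),
      (∀ t y, p.app t (i.app t y) = y) ∧ (∀ t y, l t (i.app t y) = 0) ∧
      (∀ t, p.app t (g t) = 0) ∧ (∀ t, J.Mem t → l t (g t) = 1) ∧
      (∀ t y, i.app t (p.app t y) + l t y • g t = y) ∧
      (∀ t, ¬ J.Mem t → g t = 0) ∧
      ∀ (s t : T) (h : s ≤ t), J.birth ≤ s → V.map h (g s) = g t := by
  classical
  obtain ⟨a, haS, ⟨z, hz⟩, ha⟩ := hV.exists_earliest y₀ hy₀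
  obtain ⟨b, hab, hb, hdeath⟩ := hV.exists_death z hz
  -- A functional detecting the last survivor of `z`, pulled back along the inner morphisms into
  -- time `b`, gives functionals on the whole bar. Their kernels form the complement of the interval
  -- generated by `z`.
  obtain ⟨m, hm⟩ := Module.Projective.exists_dual_eq_one F hb
  let J : Bar T := ⟨a, b, hab⟩
  let g : ∀ t, V.obj t := fun t => if h : a ≤ t then V.map h z else 0
  let l : ∀ t, V.obj t →ₗ[F] F := fun t => if h : J.Mem t then m.comp (V.map h.2) else 0
  have hg0 (t : T) (ht : ¬ J.Mem t) : g t = 0 := by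
    by_cases h : a ≤ t
    · simp only [g, h, dif_pos]
      exact hdeath t h (lt_of_not_ge fun h' => ht ⟨h, h'⟩)
    · simp [g, h]
  have hg (s t : T) (h : s ≤ t) (hs : a ≤ s) : V.map h (g s) = g t := by
    simp only [g, hs, hs.trans h, dif_pos, V.map_map]
  have hl1 (t : T) (ht : J.Mem t) : l t (g t) = 1 := by
    have : a ≤ t := ht.1
    simp only [l, g, ht, this, dif_pos, LinearMap.comp_apply, V.map_map, hm]
  have hl0 (t : T) (ht : ¬ J.Mem t) (y : V.obj t) : l t y = 0 := by
    simp [l, ht]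
  -- Here the choice of the earliest birth matters: nothing exists before `a` that could flow into
  -- the bar with a nonzero value of the functional.
  have hlmap (s t : T) (h : s ≤ t) (ht : J.Mem t) (y : V.obj s) : l t (V.map h y) = l s y := by
    by_cases hs : a ≤ s
    · have : J.Mem s := ⟨hs, h.trans ht.2⟩
      simp only [l, ht, this, dif_pos, LinearMap.comp_apply, V.map_map]
    · have := ha s (lt_of_not_ge hs)
      rw [Subsingleton.elim y 0, map_zero, map_zero, map_zero]
  have hnat (s t : T) (h : s ≤ t) (y : V.obj s) :
      l t (V.map h y) • g t = l s y • V.map h (g s) := by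
    by_cases hs : a ≤ s
    · rw [hg s t h hs]
      by_cases ht : J.Mem t
      · rw [hlmap s t h ht]
      · rw [hg0 t ht, smul_zero, smul_zero]
    · have := ha s (lt_of_not_ge hs)
      rw [Subsingleton.elim y 0, map_zero, map_zero, map_zero, zero_smul, zero_smul]
  have hker (s t : T) (h : s ≤ t) (y : V.obj s) (hy : l s y = 0) : l t (V.map h y) = 0 := by
    by_cases ht : J.Mem t
    · rw [hlmap s t h ht, hy]
    · exact hl0 t ht _
  have hpr (t : T) (y : V.obj t) : l t (y - l t y • g t) = 0 := by
    by_cases ht : J.Mem t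
    · simp [hl1 t ht]
    · exact hl0 t ht _
  let i : (V.kerModule l hker).Hom V :=
    { app := fun t => (LinearMap.ker (l t)).subtype
      naturality := fun _ _ => rfl }
  let p : V.Hom (V.kerModule l hker) :=
    { app := fun t =>
        (LinearMap.id - (l t).smulRight (g t)).codRestrict (LinearMap.ker (l t)) (hpr t)
      naturality := fun {s t} h y => by
        refine Subtype.ext ?_
        change V.map h y - l t (V.map h y) • g t = V.map h (y - l s y • g s)
        rw [hnat, map_sub, map_smul] }
  refine ⟨J, haS, g, l, V.kerModule l hker, i, p, ?_, ?_, ?_, hl1, ?_, hg0, hg⟩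
  · rintro t ⟨y, hy⟩
    refine Subtype.ext ?_
    change y - l t y • g t = y
    rw [show l t y = 0 from hy, zero_smul, sub_zero]
  · exact fun t y => y.2
  · intro t
    refine Subtype.ext ?_
    change g t - l t (g t) • g t = 0
    by_cases ht : J.Mem t
    · simp [hl1 t ht]
    · simp [hg0 t ht]
  · intro t y
    change y - l t y • g t + l t y • g t = y
    rw [sub_add_cancel]

/-- Finitely indexed pointwise finite dimensional modules have barcode bases. -/
theorem nonempty_barcodeBasis (hV : V.HasCriticalTimes S) : Nonempty V.BarcodeBasis := by
  -- Induction on the total dimension at the critical times; `S` stays fixed since complements are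
  -- retracts.
  obtain ⟨n, hn⟩ : ∃ n, ∑ s ∈ S, Module.finrank F (V.obj s) < n := ⟨_, Nat.lt_succ_self _⟩
  induction n generalizing V with
  | zero => simp at hn
  | succ n ih =>
    by_cases h0 : ∃ (t : T) (y : V.obj t), y ≠ 0
    · obtain ⟨t₀, y₀, hy₀⟩ := h0
      obtain ⟨J, hJ, g, l, U, i, p, hpi, hli, hpg, hl1, hsum, hg0, hg⟩ := hV.exists_split y₀ hy₀
      have hi (t : T) : Function.Injective (i.app t) := Function.LeftInverse.injective (hpi t)
      have hlt : ∑ s ∈ S, Module.finrank F (U.obj s) < ∑ s ∈ S, Module.finrank F (V.obj s) := by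
        have hfin := hV.1
        refine Finset.sum_lt_sum (fun s _ => LinearMap.finrank_le_finrank_of_injective (hi s))
          ⟨J.birth, hJ, ?_⟩
        refine (LinearMap.finrank_le_finrank_of_injective (hi _)).lt_of_ne fun heq => ?_
        have := (hV.of_retract i p hpi).1
        -- Equal dimensions at the birth time would put the split-off generator into the complement,
        -- where `l` vanishes.
        obtain ⟨y, hy⟩ :=
          (LinearMap.injective_iff_surjective_of_finrank_eq_finrank heq).1 (hi _) (g J.birth)
        have h1 := hl1 J.birth ⟨le_rfl, J.birth_le_death⟩
        rw [← hy, hli] at h1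
        exact zero_ne_one h1
      obtain ⟨B⟩ := ih (hV.of_retract i p hpi) (by omega)
      obtain ⟨C, -⟩ := BarcodeBasis.exists_of_coef (V := V) (ι := Option B.ι)
        (fun o => o.elim J B.bar) (fun o t => o.elim (g t) fun k => i.app t (B.gen k t))
        (fun o t => o.elim (l t) fun k => (B.coef k t).comp (p.app t))
        (by
          rintro (_ | k) s t h hs
          · exact hg s t h hs
          · exact (i.naturality h _).symm.trans (congrArg _ (B.map_gen h hs)))
        (by
          rintro (_ | k) t ht
          · exact hg0 t ht
          · exact (congrArg (i.app t) (B.gen_of_not_mem ht)).trans (map_zero _))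
        (by
          rintro (_ | k) t ht
          · exact hl1 t ht
          · exact (congrArg (B.coef k t) (hpi t _)).trans (B.coef_gen_self ht))
        (by
          rintro (_ | k) (_ | k') t hk
          · exact absurd rfl hk
          · exact hli t _
          · exact (congrArg (B.coef k t) (hpg t)).trans (map_zero _)
          · exact (congrArg (B.coef k t) (hpi t _)).trans
              (B.coef_gen_of_ne (fun h => hk (congrArg some h)) t))
        (by
          intro t y
          rw [Fintype.sum_option]
          simp only [Option.elim, LinearMap.comp_apply]
          simp only [← map_smul]
          rw [← map_sum, B.sum_coef_gen, add_comm, hsum])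
      exact ⟨C⟩
    · push Not at h0
      obtain ⟨C, -⟩ := BarcodeBasis.exists_of_coef (V := V) (ι := Empty) (fun k => k.elim)
        (fun k => k.elim) (fun k => k.elim) (fun k => k.elim) (fun k => k.elim) (fun k => k.elim)
        (fun k => k.elim) (fun t y => by simp [h0 t y])
      exact ⟨C⟩

end HasCriticalTimes

/-! ### Coarse and fine parts of a splitting -/

namespace QSplitting

variable {V : PersistenceModule.{u, v} F T} {q : ℝ} (S : V.QSplitting q)

theorem pr_incl (t : T) (y : S.coarse.obj t) : S.pr.app t (S.incl.app t y) = y :=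
  congrArg Prod.fst (S.iso.hom_inv t (y, 0))

/-- The projection to the fine part. -/
def prFine : V.Hom S.fine :=
  Hom.comp (V := S.coarse.prod S.fine)
    { app := fun t => LinearMap.snd F (S.coarse.obj t) (S.fine.obj t)
      naturality := fun _ _ => rfl } S.iso.hom

/-- The inclusion of the fine part. -/
def inclFine : S.fine.Hom V :=
  Hom.comp (V := S.coarse.prod S.fine) S.iso.inv
    { app := fun t => LinearMap.inr F (S.coarse.obj t) (S.fine.obj t)
      naturality := fun h _ =>
        Prod.ext ((S.coarse.map h).map_zero).symm rfl }

theorem prFine_inclFine (t : T) (y : S.fine.obj t) : S.prFine.app t (S.inclFine.app t y) = y :=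
  congrArg Prod.snd (S.iso.hom_inv t (0, y))

theorem pr_inclFine (t : T) (y : S.fine.obj t) : S.pr.app t (S.inclFine.app t y) = 0 :=
  congrArg Prod.fst (S.iso.hom_inv t (0, y))

theorem prFine_incl (t : T) (y : S.coarse.obj t) : S.prFine.app t (S.incl.app t y) = 0 :=
  congrArg Prod.snd (S.iso.hom_inv t (y, 0))

theorem incl_pr_add (t : T) (y : V.obj t) :
    S.incl.app t (S.pr.app t y) + S.inclFine.app t (S.prFine.app t y) = y := by
  have h := S.iso.inv_hom t y
  have h2 : S.iso.hom.app t y = (S.pr.app t y, 0) + (0, S.prFine.app t y) :=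
    Prod.ext (add_zero _).symm (zero_add _).symm
  refine Eq.trans ?_ h
  rw [h2]
  exact ((S.iso.inv.app t).map_add _ _).symm

variable {S₀ : Finset T}

theorem nonempty_basis_coarse (hV : V.HasCriticalTimes S₀) : Nonempty S.coarse.BarcodeBasis :=
  (hV.of_retract S.incl S.pr S.pr_incl).nonempty_barcodeBasis

theorem nonempty_basis_fine (hV : V.HasCriticalTimes S₀) : Nonempty S.fine.BarcodeBasis :=
  (hV.of_retract S.inclFine S.prFine S.prFine_inclFine).nonempty_barcodeBasis

/-- Every barcode basis of the coarse part extends to one of the whole module. -/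
theorem extendsAlong_incl (hV : V.HasCriticalTimes S₀) (B : S.coarse.BarcodeBasis) :
    B.ExtendsAlong S.incl := by
  obtain ⟨D⟩ := S.nonempty_basis_fine hV
  obtain ⟨C, e, hbar, hgen⟩ := BarcodeBasis.exists_of_coef (V := V) (ι := B.ι ⊕ D.ι)
    (Sum.elim B.bar D.bar)
    (fun o t => o.elim (fun k => S.incl.app t (B.gen k t)) fun k => S.inclFine.app t (D.gen k t))
    (fun o t => o.elim (fun k => (B.coef k t).comp (S.pr.app t))
      fun k => (D.coef k t).comp (S.prFine.app t))
    (by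
      rintro (k | k) s t h hs
      · exact (S.incl.naturality h _).symm.trans (congrArg _ (B.map_gen h hs))
      · exact (S.inclFine.naturality h _).symm.trans (congrArg _ (D.map_gen h hs)))
    (by
      rintro (k | k) t ht
      · exact (congrArg _ (B.gen_of_not_mem ht)).trans (map_zero _)
      · exact (congrArg _ (D.gen_of_not_mem ht)).trans (map_zero _))
    (by
      rintro (k | k) t ht
      · exact (congrArg (B.coef k t) (S.pr_incl t _)).trans (B.coef_gen_self ht)
      · exact (congrArg (D.coef k t) (S.prFine_inclFine t _)).trans (D.coef_gen_self ht))
    (by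
      rintro (k | k) (k' | k') t hk
      · exact (congrArg (B.coef k t) (S.pr_incl t _)).trans
          (B.coef_gen_of_ne (fun h => hk (congrArg Sum.inl h)) t)
      · exact (congrArg (B.coef k t) (S.pr_inclFine t _)).trans (map_zero _)
      · exact (congrArg (D.coef k t) (S.prFine_incl t _)).trans (map_zero _)
      · exact (congrArg (D.coef k t) (S.prFine_inclFine t _)).trans
          (D.coef_gen_of_ne (fun h => hk (congrArg Sum.inr h)) t))
    (by
      intro t y
      rw [Fintype.sum_sum_type]
      simp only [Sum.elim_inl, Sum.elim_inr, LinearMap.comp_apply]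
      simp only [← map_smul]
      rw [← map_sum, ← map_sum, B.sum_coef_gen, D.sum_coef_gen, incl_pr_add])
  exact ⟨C, fun i => e (Sum.inl i), fun i k h => Sum.inl.inj (e.injective h),
    fun i => hbar (Sum.inl i), fun i t => (hgen (Sum.inl i) t).symm⟩

/-- Inner morphisms over a distance of at least `q` vanish on the fine part. -/
theorem map_incl_pr (hV : V.HasCriticalTimes S₀) {s t : T} (h : s ≤ t)
    (hq : q ≤ (t : ℝ) - s) (y : V.obj s) :
    V.map h (S.incl.app s (S.pr.app s y)) = V.map h y := by
  obtain ⟨D⟩ := S.nonempty_basis_fine hV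
  have h0 : S.fine.map h = 0 := by
    refine D.hom_ext fun i hi => ?_
    rw [D.map_gen_of_death_lt h, LinearMap.zero_apply]
    have h1 := S.length_lt (D.bar i) ⟨D, i, rfl⟩
    have h2 : ((D.bar i).birth : ℝ) ≤ s := hi.1
    have h3 : ((D.bar i).death : ℝ) < t := by
      unfold Bar.length at h1
      linarith
    exact h3
  conv_rhs => rw [← S.incl_pr_add s y]
  rw [map_add, ← S.inclFine.naturality, h0, LinearMap.zero_apply, map_zero, add_zero]

end QSplitting

end PersistenceModule

/-! ### Elementary base changes and Gaussian elimination -/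

namespace PersistenceModule

variable {F : Type u} [Field F] {T : AddSubgroup ℝ}

/-- The automorphism `1 + N` for an endomorphism `N` with `N² = (r - 1) N`, `r ≠ 0`. -/
def Iso.idAdd {V : PersistenceModule.{u, v} F T} (N : V.Hom V) (r : F) (hr : r ≠ 0)
    (hN : ∀ t y, N.app t (N.app t y) = (r - 1) • N.app t y) : V.Iso V where
  hom :=
    { app := fun t => LinearMap.id + N.app t
      naturality := fun h y => by simp [N.naturality] }
  inv :=
    { app := fun t => LinearMap.id - r⁻¹ • N.app t
      naturality := fun h y => by simp [N.naturality] }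
  inv_hom t y := by
    simp only [LinearMap.sub_apply, LinearMap.add_apply, LinearMap.id_apply, LinearMap.smul_apply,
      map_add, hN, smul_smul]
    have : r⁻¹ * (r - 1) = 1 - r⁻¹ := by field_simp
    rw [this, sub_smul, one_smul]
    abel
  hom_inv t y := by
    simp only [LinearMap.sub_apply, LinearMap.add_apply, LinearMap.id_apply, LinearMap.smul_apply,
      map_sub, map_smul, hN]
    have : N.app t y + (r - 1) • N.app t y = r • N.app t y := by
      rw [sub_smul, one_smul, add_sub_cancel]
    rw [this, inv_smul_smul₀ hr, add_sub_cancel_right]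

namespace BarcodeBasis

section Elementary

variable {V : PersistenceModule.{u, v} F T} (B : V.BarcodeBasis)

/-- Naturality of the elementary endomorphism that sends the generator `k` to the generator `i`. -/
theorem coef_map_smul_gen {i k : B.ι} (hik : (B.bar i).Overlaps (B.bar k)) {s t : T} (h : s ≤ t)
    (y : V.obj s) :
    B.coef k t (V.map h y) • B.gen i t = B.coef k s y • V.map h (B.gen i s) := by
  obtain ⟨h1, h2, h3⟩ := hik
  by_cases ht : (B.bar k).Mem t
  · rw [B.coef_map h ht]
    by_cases hs : (B.bar k).Mem s
    · rw [B.map_gen h (h1.trans hs.1)]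
    · rw [B.coef_of_not_mem hs, zero_smul, zero_smul]
  · rw [B.coef_of_not_mem ht, zero_smul]
    by_cases hs : (B.bar k).Mem s
    · have : (B.bar k).death < t := lt_of_not_ge fun h' => ht ⟨hs.1.trans h, h'⟩
      rw [B.map_gen_of_death_lt h (h3.trans_lt this), smul_zero]
    · rw [B.coef_of_not_mem hs, zero_smul]

/-- There is an automorphism that subtracts multiples of the generator `i` from all other
generators. -/
theorem exists_iso_sub_smul (i : B.ι) (c : B.ι → F) (hi : c i = 0)
    (hc : ∀ k, c k ≠ 0 → (B.bar i).Overlaps (B.bar k)) :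
    ∃ e : V.Iso V, ∀ k t, (B.bar k).Mem t →
      e.hom.app t (B.gen k t) = B.gen k t - c k • B.gen i t := by
  let l : ∀ t, V.obj t →ₗ[F] F := fun t => ∑ k, c k • B.coef k t
  have hl (k : B.ι) (t : T) (hk : (B.bar k).Mem t) : l t (B.gen k t) = c k := by
    simp only [l, LinearMap.sum_apply, LinearMap.smul_apply]
    rw [Finset.sum_eq_single k (fun m _ hm => by rw [B.coef_gen_of_ne hm, smul_zero]) (by simp),
      B.coef_gen_self hk, smul_eq_mul, mul_one]
  let N : V.Hom V :=
    { app := fun t => -(l t).smulRight (B.gen i t)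
      naturality := fun {s t} h y => by
        change -(l t (V.map h y) • B.gen i t) = V.map h (-(l s y • B.gen i s))
        rw [map_neg, map_smul, neg_inj]
        simp only [l, LinearMap.sum_apply, LinearMap.smul_apply, Finset.sum_smul, smul_assoc]
        refine Finset.sum_congr rfl fun k _ => ?_
        by_cases hk : c k = 0
        · simp [hk]
        · rw [B.coef_map_smul_gen (hc k hk) h y] }
  have hN (t : T) (y : V.obj t) : N.app t y = -(l t y • B.gen i t) := rfl
  -- `r = 1`, that is `N² = 0`: the image of `N` is spanned by the generator `i`, which `l` kills
  -- because `c i = 0`.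
  refine ⟨Iso.idAdd N 1 one_ne_zero fun t y => ?_, fun k t hk => ?_⟩
  · rw [sub_self, zero_smul, hN, hN, map_neg, map_smul]
    by_cases ht : (B.bar i).Mem t
    · rw [hl i t ht, hi, smul_zero, neg_zero, zero_smul, neg_zero]
    · rw [B.gen_of_not_mem ht, smul_zero, neg_zero]
  · change B.gen k t + -(l t (B.gen k t) • B.gen i t) = _
    rw [hl k t hk, ← sub_eq_add_neg]

/-- There is an automorphism that replaces the generator `j` by a linear combination. -/
theorem exists_iso_replace (j : B.ι) (p : B.ι → F) (hj : p j ≠ 0)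
    (hp : ∀ l, p l ≠ 0 → (B.bar l).Overlaps (B.bar j)) :
    ∃ e : V.Iso V, (∀ k t, k ≠ j → e.hom.app t (B.gen k t) = B.gen k t) ∧
      (∀ t, (B.bar j).Mem t → e.hom.app t (B.gen j t) = ∑ l, p l • B.gen l t) ∧
      ∀ t y, B.coef j t y = 0 → e.inv.app t y = y := by
  classical
  -- The identity already contributes the generator `j` once, so `N` has to supply only the
  -- difference.
  let p' : B.ι → F := fun l => p l - if l = j then 1 else 0
  have hp' (l : B.ι) (hl : p' l ≠ 0) : (B.bar l).Overlaps (B.bar j) := by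
    rcases eq_or_ne l j with rfl | h
    · exact hp l hj
    · exact hp l (by simpa [p', h] using hl)
  let z : ∀ t, V.obj t := fun t => ∑ l, p' l • B.gen l t
  have hz (t : T) : z t = ∑ l, p l • B.gen l t - B.gen j t := by
    simp [z, p', sub_smul, Finset.sum_sub_distrib]
  let N : V.Hom V :=
    { app := fun t => (B.coef j t).smulRight (z t)
      naturality := fun {s t} h y => by
        simp only [LinearMap.smulRight_apply, map_smul, z, map_sum, Finset.smul_sum]
        refine Finset.sum_congr rfl fun l _ => ?_
        by_cases hl : p' l = 0
        · simp [hl]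
        · rw [smul_comm, B.coef_map_smul_gen (hp' l hl) h y, smul_comm] }
  have hN (t : T) (y : V.obj t) : N.app t y = B.coef j t y • z t := rfl
  have hcz (t : T) (ht : (B.bar j).Mem t) : B.coef j t (z t) = p j - 1 := by
    simp only [z, map_sum, map_smul]
    rw [Finset.sum_eq_single j
      (fun m _ hm => by rw [B.coef_gen_of_ne hm.symm, smul_zero]) (by simp),
      B.coef_gen_self ht, smul_eq_mul, mul_one]
    simp [p']
  -- The rank-one `N` squares to `p j - 1` times itself, the coordinate of `z` at `j`.
  refine ⟨Iso.idAdd N (p j) hj fun t y => ?_, fun k t hk => ?_, fun t ht => ?_, fun t y hy => ?_⟩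
  · rw [hN, hN, map_smul]
    by_cases ht : (B.bar j).Mem t
    · rw [hcz t ht, smul_smul, smul_eq_mul, mul_comm]
    · rw [B.coef_of_not_mem ht, B.coef_of_not_mem ht, zero_smul, zero_smul, smul_zero]
  · change B.gen k t + B.coef j t (B.gen k t) • z t = _
    rw [B.coef_gen_of_ne hk.symm, zero_smul, add_zero]
  · change B.gen j t + B.coef j t (B.gen j t) • z t = _
    rw [B.coef_gen_self ht, one_smul, hz, add_sub_cancel]
  · change y - (p j)⁻¹ • (B.coef j t y • z t) = y
    rw [hy, zero_smul, smul_zero, sub_zero]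

end Elementary

variable {X : PersistenceModule.{u, v} F T} {Y : PersistenceModule.{u, w} F T}

/-- The matrix entry of a morphism at a generator of the source and a generator of the target. -/
noncomputable def entry (f : X.Hom Y) (B : X.BarcodeBasis) (C : Y.BarcodeBasis) (j : C.ι)
    (i : B.ι) : F :=
  C.coef j (B.bar i).birth (f.app _ (B.gen i (B.bar i).birth))

section Entry

variable (f : X.Hom Y) (B : X.BarcodeBasis) (C : Y.BarcodeBasis)

/-- By naturality the matrix does not depend on time. The time `t` may lie beyond the death of `i`;
this case bounds the death of `j` below. -/
theorem coef_app_gen {i : B.ι} {j : C.ι} {t : T} (hj : (C.bar j).Mem t)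
    (hi : (B.bar i).birth ≤ t) : C.coef j t (f.app t (B.gen i t)) = entry f B C j i := by
  rw [← B.map_gen hi le_rfl, f.naturality, C.coef_map hi hj, entry]

/-- The entry is read at the birth of `i`, so `j` is alive then. Were `j` to outlive `i`, the same
entry read at the death of `j` would be a coordinate of `f 0 = 0`. -/
theorem overlaps_of_entry_ne_zero {i : B.ι} {j : C.ι} (h : entry f B C j i ≠ 0) :
    (C.bar j).Overlaps (B.bar i) := by
  have hmem : (C.bar j).Mem (B.bar i).birth := by_contra fun h' => h (C.coef_of_not_mem h' _)
  refine ⟨hmem.1, hmem.2, le_of_not_gt fun hlt => h ?_⟩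
  rw [← coef_app_gen f B C ⟨(C.bar j).birth_le_death, le_rfl⟩
    ((B.bar i).birth_le_death.trans hlt.le), B.gen_of_not_mem fun h' => hlt.not_ge h'.2,
    map_zero, map_zero]

theorem app_gen {i : B.ι} {t : T} (hi : (B.bar i).birth ≤ t) :
    f.app t (B.gen i t) = ∑ j, entry f B C j i • C.gen j t := by
  rw [← C.sum_coef_gen t (f.app t (B.gen i t))]
  refine Finset.sum_congr rfl fun j _ => ?_
  by_cases hj : (C.bar j).Mem t
  · rw [coef_app_gen f B C hj hi]
  · rw [C.gen_of_not_mem hj, smul_zero, smul_zero]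

end Entry

/-- A partial matching of the generators along a morphism: matched generators are mapped to each
other, and images of unmatched generators have no component at matched ones. -/
structure IsPartialMatching (f : X.Hom Y) (B : X.BarcodeBasis) (C : Y.BarcodeBasis)
    (m : B.ι → Option C.ι) : Prop where
  inj : ∀ {i k j}, m i = some j → m k = some j → i = k
  overlaps : ∀ {i j}, m i = some j → (C.bar j).Overlaps (B.bar i)
  -- The restriction to the bar of `i` is needed: the bar of `j` may begin earlier.
  app_gen : ∀ {i j}, m i = some j → ∀ t, (B.bar i).Mem t → f.app t (B.gen i t) = C.gen j t
  coef_eq_zero : ∀ {i k j}, m i = none → m k = some j → ∀ t, C.coef j t (f.app t (B.gen i t)) = 0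

/-- All strictly nested pairs in a family of bars have gaps larger than `η` at both ends. -/
def NestedGaps {ι : Type} (bar : ι → Bar T) (η : T) : Prop :=
  ∀ i k, (bar i).StrictlyNested (bar k) →
    (bar k).birth + η < (bar i).birth ∧ (bar i).death + η < (bar k).death

/-- The kernel of `f` vanishes under the inner morphisms over a distance `η`. -/
def KerTrivial (f : X.Hom Y) (η : T) : Prop :=
  ∀ (t u : T) (h : t ≤ u), u = t + η → ∀ y, f.app t y = 0 → X.map h y = 0

/-- The cokernel of `f` vanishes under the inner morphisms over a distance `η`. -/
def CokerTrivial (f : X.Hom Y) (η : T) : Prop :=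
  ∀ (t u : T) (h : t ≤ u), u = t + η → ∀ y, ∃ x, f.app u x = Y.map h y

theorem exists_max_lex {ι : Type*} [Finite ι] (p : ι → Prop) (hp : ∃ i, p i) (a b : ι → T) :
    ∃ i, p i ∧ ∀ k, p k → a k ≤ a i ∧ (a k = a i → b k ≤ b i) := by
  classical
  have := Fintype.ofFinite ι
  obtain ⟨i₀, hi₀⟩ := hp
  obtain ⟨i, hi, hmax⟩ := (Finset.univ.filter p).exists_max_image (fun i => toLex (a i, b i))
    ⟨i₀, by simpa using hi₀⟩
  simp only [Finset.mem_filter, Finset.mem_univ, true_and, Prod.Lex.toLex_le_toLex] at hi hmax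
  refine ⟨i, hi, fun k hk => ⟨?_, fun h => ?_⟩⟩
  · rcases hmax k hk with h | h
    exacts [h.le, h.1.le]
  · rcases hmax k hk with h' | h'
    exacts [absurd h h'.ne, h'.2]

theorem exists_min_lex {ι : Type*} [Finite ι] (p : ι → Prop) (hp : ∃ i, p i) (a b : ι → T) :
    ∃ i, p i ∧ ∀ k, p k → a i ≤ a k ∧ (a k = a i → b i ≤ b k) := by
  obtain ⟨i, hi, h⟩ := exists_max_lex p hp (fun i => -a i) fun i => -b i
  exact ⟨i, hi, fun k hk => ⟨neg_le_neg_iff.1 (h k hk).1,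
    fun h' => neg_le_neg_iff.1 ((h k hk).2 (congrArg Neg.neg h'))⟩⟩

/-- A pivot entry: minimal in its row and maximal in its column. -/
theorem exists_pivot {f : X.Hom Y} {B : X.BarcodeBasis} {C : Y.BarcodeBasis}
    {m : B.ι → Option C.ι} (hm : IsPartialMatching f B C m) {η : T} (hη : 0 ≤ η)
    (hB : NestedGaps B.bar η) (hC : NestedGaps C.bar η) (hker : KerTrivial f η)
    (hcoker : CokerTrivial f η) (hne : ∃ i j, m i = none ∧ entry f B C j i ≠ 0) :
    ∃ i j, m i = none ∧ entry f B C j i ≠ 0 ∧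
      (∀ k, m k = none → entry f B C j k ≠ 0 → (B.bar i).Overlaps (B.bar k)) ∧
      ∀ l, entry f B C l i ≠ 0 → (C.bar l).Overlaps (C.bar j) := by
  obtain ⟨i₀, j₀, hi₀, hj₀⟩ := hne
  -- Row of latest death, then latest birth, among all rows met by unmatched columns; next, the
  -- column of earliest death, then earliest birth, in this row. The tie-breaks turn a wrong order
  -- of births into strict nesting.
  obtain ⟨j, ⟨i₁, hi₁, hji₁⟩, hj⟩ :=
    exists_max_lex (fun j => ∃ i, m i = none ∧ entry f B C j i ≠ 0) ⟨j₀, i₀, hi₀, hj₀⟩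
      (fun j => (C.bar j).death) fun j => (C.bar j).birth
  obtain ⟨i, ⟨hi, hji⟩, hmin⟩ :=
    exists_min_lex (fun i => m i = none ∧ entry f B C j i ≠ 0) ⟨i₁, hi₁, hji₁⟩
      (fun i => (B.bar i).death) fun i => (B.bar i).birth
  obtain ⟨h1, h2, h3⟩ := overlaps_of_entry_ne_zero f B C hji
  have hrow (k : B.ι) (hk : m k = none) (hjk : entry f B C j k ≠ 0) :
      (B.bar i).birth ≤ (B.bar k).birth := by
    obtain ⟨h4, h5⟩ := hmin k ⟨hk, hjk⟩
    by_contra! hlt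
    have hd : (B.bar i).death < (B.bar k).death := h4.lt_of_ne fun h => (h5 h.symm).not_gt hlt
    obtain ⟨-, hgap⟩ := hB i k ⟨hlt, hd⟩
    have hu : (B.bar i).death < (B.bar k).death - η := lt_sub_iff_add_lt.2 hgap
    have hle : (B.bar k).death - η ≤ (B.bar k).death := sub_le_self _ hη
    -- At time `death k - η`, later than the death of `i`, the generator `k` still has η to live, so
    -- it is not in the kernel of `f`. A target generator `l` in its image is then alive after `i`,
    -- hence after `j`, against the choice of `j`.
    have hbirth : (B.bar k).birth ≤ (B.bar k).death - η :=
      (hlt.le.trans (B.bar i).birth_le_death).trans hu.le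
    have hfne : f.app _ (B.gen k ((B.bar k).death - η)) ≠ 0 := fun h0 => by
      have := hker _ _ hle (sub_add_cancel _ _).symm _ h0
      rw [B.map_gen hle hbirth] at this
      exact B.gen_ne_zero ⟨(B.bar k).birth_le_death, le_rfl⟩ this
    rw [BarcodeBasis.app_gen f B C hbirth] at hfne
    obtain ⟨l, -, hl⟩ := Finset.exists_ne_zero_of_sum_ne_zero hfne
    have hl1 : entry f B C l k ≠ 0 := fun h => hl (by rw [h, zero_smul])
    have hl2 : (C.bar l).Mem ((B.bar k).death - η) :=
      by_contra fun h => hl (by rw [C.gen_of_not_mem h, smul_zero])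
    exact (hl2.2.trans ((hj l ⟨k, hk, hl1⟩).1.trans h3)).not_gt hu
  refine ⟨i, j, hi, hji, fun k hk hjk => ?_, fun l hl => ?_⟩
  · exact ⟨hrow k hk hjk, (overlaps_of_entry_ne_zero f B C hjk).2.1.trans h3,
      (hmin k ⟨hk, hjk⟩).1⟩
  · obtain ⟨h4, h5⟩ := hj l ⟨i, hi, hl⟩
    obtain ⟨h6, h7, -⟩ := overlaps_of_entry_ne_zero f B C hl
    refine ⟨?_, h1.trans h7, h4⟩
    by_contra! hlt
    have hd : (C.bar l).death < (C.bar j).death := h4.lt_of_ne fun h => (h5 h).not_gt hlt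
    obtain ⟨hgap, hgap'⟩ := hC l j ⟨hlt, hd⟩
    have hle : (C.bar j).birth ≤ (C.bar j).birth + η := le_add_of_nonneg_right hη
    have hmem : (C.bar j).Mem ((C.bar j).birth + η) :=
      ⟨hle, (hgap.le.trans (C.bar l).birth_le_death).trans hd.le⟩
    -- By time `birth j + η` the generator `j` lies in the image of `f`, while `l` is not yet born.
    -- Some source generator `k` alive at that time thus has a nonzero entry in row `j`.
    obtain ⟨x, hx⟩ := hcoker _ _ hle rfl (C.gen j (C.bar j).birth)
    rw [C.map_gen hle le_rfl] at hx
    have h8 : C.coef j _ (f.app _ x) ≠ 0 := by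
      rw [hx, C.coef_gen_self hmem]
      exact one_ne_zero
    rw [← B.sum_coef_gen _ x, map_sum, map_sum] at h8
    obtain ⟨k, -, hk⟩ := Finset.exists_ne_zero_of_sum_ne_zero h8
    rw [map_smul, map_smul] at hk
    have hk1 : (B.bar k).Mem ((C.bar j).birth + η) :=
      by_contra fun h => hk (by rw [B.coef_of_not_mem h, zero_smul])
    have hk2 := right_ne_zero_of_smul hk
    rw [coef_app_gen f B C hmem hk1.1] at hk2
    -- A matched `k` could only be matched to `j`, but then the unmatched `i` would have no
    -- component at `j`.
    have hk3 : m k = none := by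
      by_contra hne
      obtain ⟨j', hj'⟩ := Option.ne_none_iff_exists'.1 hne
      have hjj : j = j' := by
        by_contra hjj
        rw [← coef_app_gen f B C hmem hk1.1, hm.app_gen hj' _ hk1, C.coef_gen_of_ne hjj] at hk2
        exact hk2 rfl
      subst hjj
      exact hji (hm.coef_eq_zero hi hj' _)
    -- `birth i ≤ birth k ≤ birth j + η < birth l ≤ birth i`.
    exact ((hrow k hk3 hk2).trans hk1.1).not_gt (hgap.trans_le h6)

/-- A pivot allows to match one more pair of generators after a change of bases. -/
theorem IsPartialMatching.exists_extend {f : X.Hom Y} {B : X.BarcodeBasis} {C : Y.BarcodeBasis}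
    {m : B.ι → Option C.ι} (hm : IsPartialMatching f B C m) {i : B.ι} {j : C.ι}
    (hi : m i = none) (hji : entry f B C j i ≠ 0)
    (hrow : ∀ k, m k = none → entry f B C j k ≠ 0 → (B.bar i).Overlaps (B.bar k))
    (hcol : ∀ l, entry f B C l i ≠ 0 → (C.bar l).Overlaps (C.bar j)) :
    ∃ (e : X.Iso X) (e' : Y.Iso Y) (m' : B.ι → Option C.ι),
      IsPartialMatching f (B.map e) (C.map e') m' ∧ m' i ≠ none ∧ ∀ k, m k ≠ none → m' k ≠ none := by
  classical
  -- Row `j` is cleared only in unmatched columns; matched columns have no entry there.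
  let c : B.ι → F := fun k =>
    if m k = none ∧ k ≠ i then entry f B C j k / entry f B C j i else 0
  obtain ⟨e, he⟩ := B.exists_iso_sub_smul i c (by simp [c]) (fun k hk => by
    by_cases h : m k = none ∧ k ≠ i
    · exact hrow k h.1 fun h0 => hk (by simp [c, h0])
    · exact absurd (by simp [c, h]) hk)
  -- The new generator `j` is the image of `i`, continued back to the birth of `j`.
  obtain ⟨e', he1, he2, he3⟩ := C.exists_iso_replace j (fun l => entry f B C l i) hji hcol
  have hj (k : B.ι) : m k ≠ some j := fun hk => hji (hm.coef_eq_zero hi hk _)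
  have hfix (k : B.ι) (hk : ¬ (m k = none ∧ k ≠ i)) (t : T) (ht : (B.bar k).Mem t) :
      (B.map e).gen k t = B.gen k t := by
    refine (B.gen_map e k t).trans ?_
    rw [he k t ht]
    simp [c, hk]
  have hcoef (k : B.ι) (hk : m k = none) (hki : k ≠ i) (t : T) (ht : (B.bar k).Mem t) :
      C.coef j t (f.app t (B.gen k t - c k • B.gen i t)) = 0 := by
    rw [map_sub, map_sub, map_smul, map_smul]
    by_cases hjt : (C.bar j).Mem t
    · rw [coef_app_gen f B C hjt ht.1]
      by_cases h0 : entry f B C j k = 0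
      · simp [c, h0]
      · rw [coef_app_gen f B C hjt ((hrow k hk h0).1.trans ht.1)]
        simp [c, hk, hki, hji]
    · rw [C.coef_of_not_mem hjt, C.coef_of_not_mem hjt, smul_zero, sub_zero]
  refine ⟨e, e', Function.update m i (some j), ⟨?_, ?_, ?_, ?_⟩, by simp, fun k hk => ?_⟩
  · intro k k' l hk hk'
    by_cases hki : k = i <;> by_cases hki' : k' = i
    · rw [hki, hki']
    · rw [hki, Function.update_self] at hk
      rw [Function.update_of_ne hki', ← hk] at hk'
      exact absurd hk' (hj k')
    · rw [hki', Function.update_self] at hk'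
      rw [Function.update_of_ne hki, ← hk'] at hk
      exact absurd hk (hj k)
    · rw [Function.update_of_ne hki] at hk
      rw [Function.update_of_ne hki'] at hk'
      exact hm.inj hk hk'
  · intro k l hk
    rcases eq_or_ne k i with rfl | hki
    · rw [Function.update_self, Option.some_inj] at hk
      subst hk
      exact overlaps_of_entry_ne_zero f B C hji
    · rw [Function.update_of_ne hki] at hk
      exact hm.overlaps hk
  · intro k l hk t ht
    rcases eq_or_ne k i with rfl | hki
    · rw [Function.update_self, Option.some_inj] at hk
      subst hk
      refine (congrArg (f.app t) (hfix k (by simp) t ht)).trans (Eq.trans ?_ (C.gen_map e' j t).symm)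
      rw [BarcodeBasis.app_gen f B C ht.1]
      by_cases hjt : (C.bar j).Mem t
      · rw [he2 t hjt]
      -- While `i` is alive, `j` can be missing only because it has died; by `hcol` every component
      -- of the image of `i` has then died too.
      · rw [C.gen_of_not_mem hjt, map_zero]
        refine Finset.sum_eq_zero fun l _ => ?_
        by_cases hl : entry f B C l k = 0
        · rw [hl, zero_smul]
        · rw [C.gen_of_not_mem fun h => hjt
            ⟨(overlaps_of_entry_ne_zero f B C hji).1.trans ht.1, h.2.trans (hcol l hl).2.2⟩,
            smul_zero]
    · rw [Function.update_of_ne hki] at hk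
      refine (congrArg (f.app t) (hfix k (by simp [hk]) t ht)).trans
        (Eq.trans ?_ (C.gen_map e' l t).symm)
      rw [he1 l t fun h => hj k (h ▸ hk)]
      exact hm.app_gen hk t ht
  · intro k k' l hk hk' t
    rcases eq_or_ne k i with rfl | hki
    · simp at hk
    rw [Function.update_of_ne hki] at hk
    by_cases ht : (B.bar k).Mem t
    · have h1 : f.app t ((B.map e).gen k t) = f.app t (B.gen k t - c k • B.gen i t) :=
        congrArg (f.app t) ((B.gen_map e k t).trans (he k t ht))
      have h2 := (C.coef_map_iso e' l t (f.app t ((B.map e).gen k t)))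
      -- A vector without `j`-component has the same coordinates in the old and the new target
      -- basis, so the vanishing at matched generators persists.
      rw [h1, he3 t _ (hcoef k hk hki t ht)] at h2
      rw [h1]
      refine h2.trans ?_
      rcases eq_or_ne k' i with rfl | hki'
      · rw [Function.update_self, Option.some_inj] at hk'
        subst hk'
        exact hcoef k hk hki t ht
      · rw [Function.update_of_ne hki'] at hk'
        rw [map_sub, map_sub, map_smul, map_smul, hm.coef_eq_zero hk hk', hm.coef_eq_zero hi hk',
          smul_zero, sub_zero]
    · have h1 : (B.map e).gen k t = 0 := (B.map e).gen_of_not_mem ht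
      rw [h1, map_zero, map_zero]
  · rcases eq_or_ne k i with rfl | hki
    · simp
    · rwa [Function.update_of_ne hki]

/-- A morphism with `η`-trivial kernel and cokernel between modules whose strictly nested bars have
gaps larger than `η` matches generators to generators or to `0` in suitable barcode bases. -/
theorem exists_matching (f : X.Hom Y) (B : X.BarcodeBasis) (C : Y.BarcodeBasis) {η : T}
    (hη : 0 ≤ η) (hB : NestedGaps B.bar η) (hC : NestedGaps C.bar η) (hker : KerTrivial f η)
    (hcoker : CokerTrivial f η) :
    ∃ (B' : X.BarcodeBasis) (C' : Y.BarcodeBasis) (m : B'.ι → Option C'.ι),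
      IsPartialMatching f B' C' m ∧ ∀ i t, m i = none → f.app t (B'.gen i t) = 0 := by
  classical
  -- Induction on the number of unmatched source generators, starting from the empty matching; the
  -- bases change at each step but the bars do not, so the gap conditions carry over.
  suffices H : ∀ (n : ℕ) (B : X.BarcodeBasis) (C : Y.BarcodeBasis) (m : B.ι → Option C.ι),
      NestedGaps B.bar η → NestedGaps C.bar η → IsPartialMatching f B C m →
      (Finset.univ.filter fun i => m i = none).card < n →
      ∃ (B' : X.BarcodeBasis) (C' : Y.BarcodeBasis) (m : B'.ι → Option C'.ι),
        IsPartialMatching f B' C' m ∧ ∀ i t, m i = none → f.app t (B'.gen i t) = 0 from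
    H _ B C (fun _ => none) hB hC ⟨by simp, by simp, by simp, by simp⟩ (Nat.lt_succ_self _)
  intro n
  induction n with
  | zero => intro B C m _ _ _ hn; simp at hn
  | succ n ih =>
    intro B C m hB hC hm hn
    by_cases hne : ∃ i j, m i = none ∧ entry f B C j i ≠ 0
    · obtain ⟨i, j, hi, hji, hrow, hcol⟩ := exists_pivot hm hη hB hC hker hcoker hne
      obtain ⟨e, e', m', hm', hi', hmono⟩ := hm.exists_extend hi hji hrow hcol
      refine ih (B.map e) (C.map e') m' hB hC hm' (lt_of_lt_of_le ?_ (Nat.lt_succ_iff.1 hn))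
      refine Finset.card_lt_card (Finset.ssubset_iff_of_subset ?_ |>.2 ⟨i, ?_, ?_⟩)
      · intro k hk
        simp only [Finset.mem_filter, Finset.mem_univ, true_and] at hk ⊢
        exact by_contra fun h => hmono k h hk
      · simpa using hi
      · simpa using hi'
    · push Not at hne
      refine ⟨B, C, m, hm, fun i t hi => ?_⟩
      by_cases ht : (B.bar i).Mem t
      · rw [BarcodeBasis.app_gen f B C ht.1]
        exact Finset.sum_eq_zero fun j _ => by rw [hne i j hi, zero_smul]
      · rw [B.gen_of_not_mem ht, map_zero]

end BarcodeBasis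

end PersistenceModule

/-! ### From matched bases to direct sums of elementary ladders -/

namespace PersistenceModule

variable {F : Type u} [Field F] {T : AddSubgroup ℝ}

/-- A barcode basis identifies a module with a direct sum of modules that are zero or generated by
a single generator with the corresponding bar. -/
theorem BarcodeBasis.exists_iso_directSum {V : PersistenceModule.{u, v} F T} (B : V.BarcodeBasis)
    {κ : Type} [DecidableEq κ] (M : κ → PersistenceModule.{u, u} F T)
    (e : ∀ k t, (M k).obj t) (c : ∀ k t, (M k).obj t →ₗ[F] F) (n : B.ι → κ)
    (hn : Function.Injective n) (hce : ∀ k t y, c k t y • e k t = y)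
    (hone : ∀ i t, (B.bar i).Mem t → c (n i) t (e (n i) t) = 1)
    (hzero : ∀ i t, ¬ (B.bar i).Mem t → e (n i) t = 0)
    (hzero' : ∀ k, k ∉ Set.range n → ∀ t, e k t = 0)
    (hmap : ∀ i (s t : T) (h : s ≤ t), (B.bar i).birth ≤ s → (M (n i)).map h (e (n i) s) =
      e (n i) t) :
    ∃ E : V.Iso (directSum M), ∀ i t, E.hom.app t (B.gen i t) =
      DirectSum.of (fun k => (M k).obj t) (n i) (e (n i) t) := by
  let f (t : T) : V.obj t →ₗ[F] DirectSum κ fun k => (M k).obj t :=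
    ∑ i, (B.coef i t).smulRight (DirectSum.lof F κ (fun k => (M k).obj t) (n i) (e (n i) t))
  let g (t : T) : (DirectSum κ fun k => (M k).obj t) →ₗ[F] V.obj t :=
    ∑ i, ((c (n i) t).comp (DirectSum.component F κ (fun k => (M k).obj t) (n i))).smulRight
      (B.gen i t)
  have hf (i : B.ι) (t : T) :
      f t (B.gen i t) = DirectSum.lof F κ (fun k => (M k).obj t) (n i) (e (n i) t) := by
    by_cases ht : (B.bar i).Mem t
    · simp only [f, LinearMap.sum_apply, LinearMap.smulRight_apply]
      rw [Finset.sum_eq_single i (fun k _ hk => by rw [B.coef_gen_of_ne hk, zero_smul]) (by simp),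
        B.coef_gen_self ht, one_smul]
    · rw [B.gen_of_not_mem ht, hzero i t ht, map_zero, map_zero]
  have hg (i : B.ι) (t : T) (y : (M (n i)).obj t) :
      g t (DirectSum.lof F κ (fun k => (M k).obj t) (n i) y) = c (n i) t y • B.gen i t := by
    simp only [g, LinearMap.sum_apply, LinearMap.smulRight_apply, LinearMap.comp_apply]
    rw [Finset.sum_eq_single i (fun k _ hk => ?_) (by simp), DirectSum.component.lof_self]
    rw [DirectSum.component.of, dif_neg fun h => hk (hn h).symm, map_zero, zero_smul]
  have hgf (t : T) (y : V.obj t) : g t (f t y) = y := by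
    have : (g t).comp (f t) = LinearMap.id := B.hom_ext fun i hi => by
      rw [LinearMap.comp_apply, hf, hg, hone i t hi, one_smul, LinearMap.id_apply]
    exact LinearMap.congr_fun this y
  have hfg (t : T) (y : DirectSum κ fun k => (M k).obj t) : f t (g t y) = y := by
    have : (f t).comp (g t) = LinearMap.id := by
      refine DirectSum.linearMap_ext _ fun k => LinearMap.ext fun z => ?_
      simp only [LinearMap.comp_apply, LinearMap.id_apply]
      by_cases hk : k ∈ Set.range n
      · obtain ⟨i, rfl⟩ := hk
        rw [hg, map_smul, hf, ← map_smul, hce]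
      -- Summands outside the range of `n` vanish; they come from blocks with nothing on the side
      -- considered.
      · have hz : z = 0 := by rw [← hce k t z, hzero' k hk, smul_zero]
        rw [hz, map_zero, map_zero, map_zero]
    exact LinearMap.congr_fun this y
  have hnat (s t : T) (h : s ≤ t) (y : V.obj s) :
      f t (V.map h y) = (directSum M).map h (f s y) := by
    have : (f t).comp (V.map h) = ((directSum M).map h).comp (f s) := B.hom_ext fun i hi => by
      refine (congrArg (f t) (B.map_gen h hi.1)).trans ((hf i t).trans (Eq.symm ?_))
      refine (congrArg ((directSum M).map h) (hf i s)).trans ?_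
      refine (DirectSum.lmap_lof _ _ _).trans ?_
      rw [hmap i s t h hi.1]
    exact LinearMap.congr_fun this y
  refine ⟨⟨⟨f, fun h y => hnat _ _ h y⟩, ⟨g, fun {s t} h y => ?_⟩, hgf, hfg⟩, hf⟩
  have h1 := (hnat s t h (g s y)).trans (congrArg _ (hfg s y))
  exact (congrArg (g t) h1.symm).trans (hgf t _)

/-- The coordinate of an interval module with respect to its generator. -/
def intervalCoef (J : Bar T) (t : T) : (interval F J).obj t →ₗ[F] F :=
  (intervalSpace F J t).subtype

open Classical in
theorem intervalCoef_smul (J : Bar T) (t : T) (y : (interval F J).obj t) :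
    intervalCoef J t y • intervalGen F J t = y := by
  obtain ⟨y, hy⟩ := y
  refine Subtype.ext ?_
  change y * (if J.Mem t then 1 else 0) = y
  by_cases h : J.Mem t
  · simp [h]
  · simp [h, hy h]

theorem intervalCoef_gen (J : Bar T) (t : T) (h : J.Mem t) :
    intervalCoef J t (intervalGen F J t) = 1 :=
  if_pos h

theorem intervalGen_of_not_mem (J : Bar T) (t : T) (h : ¬ J.Mem t) : intervalGen F J t = 0 :=
  Subtype.ext (if_neg h)

open Classical in
theorem intervalMap_gen (K J : Bar T) (s t : T) (h : J.Mem t → K.Mem s) :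
    intervalMap F K J s t (intervalGen F K s) = intervalGen F J t := by
  refine Subtype.ext ?_
  change (if J.Mem t then (if K.Mem s then (1 : F) else 0) else 0) = if J.Mem t then 1 else 0
  by_cases ht : J.Mem t
  · simp [h ht]
  · simp [ht]

theorem interval_map_gen (J : Bar T) {s t : T} (h : s ≤ t) (hs : J.birth ≤ s) :
    (interval F J).map h (intervalGen F J s) = intervalGen F J t :=
  intervalMap_gen J J s t fun ht => ⟨hs, h.trans ht.2⟩

end PersistenceModule

namespace LadderBlock

variable {F : Type u} [Field F] {T : AddSubgroup ℝ}

/-- The coordinate on the source side of a block. -/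
noncomputable def srcCoef : ∀ (b : LadderBlock T) (t : T), (b.toLadder F).src.obj t →ₗ[F] F
  | R _ K _, t => intervalCoef K t
  | IPlus J, t => intervalCoef J t
  | IMinus _, _ => 0

/-- The coordinate on the target side of a block. -/
noncomputable def tgtCoef : ∀ (b : LadderBlock T) (t : T), (b.toLadder F).tgt.obj t →ₗ[F] F
  | R J _ _, t => intervalCoef J t
  | IPlus _, _ => 0
  | IMinus K, t => intervalCoef K t

theorem srcCoef_smul (b : LadderBlock T) (t : T) (y : (b.toLadder F).src.obj t) :
    b.srcCoef t y • b.srcGen F t = y := by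
  cases b with
  | R J K h => exact intervalCoef_smul K t y
  | IPlus J => exact intervalCoef_smul J t y
  | IMinus K => rfl

theorem tgtCoef_smul (b : LadderBlock T) (t : T) (y : (b.toLadder F).tgt.obj t) :
    b.tgtCoef t y • b.tgtGen F t = y := by
  cases b with
  | R J K h => exact intervalCoef_smul J t y
  | IPlus J => rfl
  | IMinus K => exact intervalCoef_smul K t y

/-- An isomorphism of a module with the source side of a sum of blocks from a barcode basis. -/
theorem exists_iso_src {V : PersistenceModule.{u, v} F T} (B : V.BarcodeBasis) {κ : Type}
    [DecidableEq κ] (b : κ → LadderBlock T) (n : B.ι → κ) (hn : Function.Injective n)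
    (hbar : ∀ i, (b (n i)).srcBar = some (B.bar i))
    (hnone : ∀ k, k ∉ Set.range n → (b k).srcBar = none) :
    ∃ E : V.Iso (PersistenceModule.directSum fun k => ((b k).toLadder F).src),
      ∀ i t, E.hom.app t (B.gen i t) =
        DirectSum.of (fun k => ((b k).toLadder F).src.obj t) (n i) ((b (n i)).srcGen F t) := by
  refine B.exists_iso_directSum (fun k => ((b k).toLadder F).src) (fun k t => (b k).srcGen F t)
    (fun k t => (b k).srcCoef t) n hn (fun k t y => srcCoef_smul _ t y) (fun i t ht => ?_)
    (fun i t ht => ?_) (fun k hk t => ?_) (fun i s t h hs => ?_)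
  · have h := hbar i
    revert h
    cases b (n i) <;> rintro ⟨⟩
    exacts [intervalCoef_gen _ t ht, intervalCoef_gen _ t ht]
  · have h := hbar i
    revert h
    cases b (n i) <;> rintro ⟨⟩
    exacts [intervalGen_of_not_mem _ t ht, intervalGen_of_not_mem _ t ht]
  · have h := hnone k hk
    revert h
    cases b k <;> rintro ⟨⟩
    rfl
  · have h' := hbar i
    revert h'
    cases b (n i) <;> rintro ⟨⟩
    exacts [interval_map_gen _ h hs, interval_map_gen _ h hs]

/-- An isomorphism of a module with the target side of a sum of blocks from a barcode basis. -/
theorem exists_iso_tgt {V : PersistenceModule.{u, v} F T} (B : V.BarcodeBasis) {κ : Type}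
    [DecidableEq κ] (b : κ → LadderBlock T) (n : B.ι → κ) (hn : Function.Injective n)
    (hbar : ∀ i, (b (n i)).tgtBar = some (B.bar i))
    (hnone : ∀ k, k ∉ Set.range n → (b k).tgtBar = none) :
    ∃ E : V.Iso (PersistenceModule.directSum fun k => ((b k).toLadder F).tgt),
      ∀ i t, E.hom.app t (B.gen i t) =
        DirectSum.of (fun k => ((b k).toLadder F).tgt.obj t) (n i) ((b (n i)).tgtGen F t) := by
  refine B.exists_iso_directSum (fun k => ((b k).toLadder F).tgt) (fun k t => (b k).tgtGen F t)
    (fun k t => (b k).tgtCoef t) n hn (fun k t y => tgtCoef_smul _ t y) (fun i t ht => ?_)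
    (fun i t ht => ?_) (fun k hk t => ?_) (fun i s t h hs => ?_)
  · have h := hbar i
    revert h
    cases b (n i) <;> rintro ⟨⟩
    exacts [intervalCoef_gen _ t ht, intervalCoef_gen _ t ht]
  · have h := hbar i
    revert h
    cases b (n i) <;> rintro ⟨⟩
    exacts [intervalGen_of_not_mem _ t ht, intervalGen_of_not_mem _ t ht]
  · have h := hnone k hk
    revert h
    cases b k <;> rintro ⟨⟩
    rfl
  · have h' := hbar i
    revert h'
    cases b (n i) <;> rintro ⟨⟩
    exacts [interval_map_gen _ h hs, interval_map_gen _ h hs]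

theorem hom_srcGen_R {J K : Bar T} (h : J.Overlaps K) (t : T) (ht : K.Mem t) :
    ((R J K h).toLadder F).hom.app t ((R J K h).srcGen F t) = (R J K h).tgtGen F t :=
  intervalMap_gen K J t t fun _ => ht

end LadderBlock

namespace PersistenceModule

variable {F : Type u} [Field F] {T : AddSubgroup ℝ}

/-- A morphism that sends generators to matched generators or to `0` has a ladder decomposition
obtained in the given barcode bases. -/
theorem exists_ladderDecomposition {X : PersistenceModule.{u, v} F T}
    {Y : PersistenceModule.{u, w} F T} (f : X.Hom Y) (B : X.BarcodeBasis) (C : Y.BarcodeBasis)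
    (m : B.ι → Option C.ι) (hinj : ∀ {i k j}, m i = some j → m k = some j → i = k)
    (hov : ∀ {i j}, m i = some j → (C.bar j).Overlaps (B.bar i))
    (hsome : ∀ {i j}, m i = some j → ∀ t, (B.bar i).Mem t → f.app t (B.gen i t) = C.gen j t)
    (hnone : ∀ i t, m i = none → f.app t (B.gen i t) = 0) :
    ∃ D : LadderDecomposition f, D.IsObtainedIn B C := by
  classical
  let P : C.ι → Prop := fun j => ∀ i, m i ≠ some j
  -- The value of `m i` is a separate argument because an R block contains a proof of overlap
  -- depending on it; `hb'` removes this dependence.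
  let b' : ∀ (i : B.ι) (o : Option C.ι), m i = o → LadderBlock T := fun i o =>
    match o with
    | none => fun _ => .IPlus (B.bar i)
    | some j => fun h => .R (C.bar j) (B.bar i) (hov h)
  have hb' (i : B.ι) (o : Option C.ι) (h : m i = o) : b' i o h = b' i (m i) rfl := by
    subst h; rfl
  let b : B.ι ⊕ {j // P j} → LadderBlock T :=
    Sum.elim (fun i => b' i (m i) rfl) fun j => .IMinus (C.bar j)
  have hb_some {i : B.ι} {j : C.ι} (h : m i = some j) :
      b (Sum.inl i) = .R (C.bar j) (B.bar i) (hov h) := (hb' i _ h).symm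
  have hb_none {i : B.ι} (h : m i = none) : b (Sum.inl i) = .IPlus (B.bar i) := (hb' i _ h).symm
  -- A matched target generator lives in the block of its source partner, unique by `hinj`; an
  -- unmatched one has a block of its own.
  let n' : C.ι → B.ι ⊕ {j // P j} := fun j =>
    if h : P j then Sum.inr ⟨j, h⟩ else Sum.inl (not_forall_not.1 h).choose
  have hn'_some {i : B.ι} {j : C.ι} (h : m i = some j) : n' j = Sum.inl i := by
    have hP : ¬ P j := fun hP => hP i h
    simp only [n', hP, dif_neg, not_false_eq_true]
    exact congrArg Sum.inl (hinj (not_forall_not.1 hP).choose_spec h)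
  have hn'_none {j : C.ι} (h : P j) : n' j = Sum.inr ⟨j, h⟩ := dif_pos h
  have hcases (j : C.ι) : (∃ i, m i = some j) ∨ P j := by
    by_cases h : P j
    · exact Or.inr h
    · exact Or.inl (not_forall_not.1 h)
  have hn' : Function.Injective n' := by
    intro j k h
    rcases hcases j with ⟨i, hi⟩ | hj <;> rcases hcases k with ⟨i', hi'⟩ | hk
    · rw [hn'_some hi, hn'_some hi'] at h
      rw [Sum.inl.inj h, hi'] at hi
      exact (Option.some_inj.1 hi).symm
    · rw [hn'_some hi, hn'_none hk] at h
      cases h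
    · rw [hn'_some hi', hn'_none hj] at h
      cases h
    · rw [hn'_none hj, hn'_none hk] at h
      exact congrArg Subtype.val (Sum.inr.inj h)
  have hsrc (i : B.ι) : (b (Sum.inl i)).srcBar = some (B.bar i) := by
    rcases h : m i with _ | j
    · rw [hb_none h]; rfl
    · rw [hb_some h]; rfl
  have hsrc' (k) (hk : k ∉ Set.range (Sum.inl : B.ι → B.ι ⊕ {j // P j})) :
      (b k).srcBar = none := by
    rcases k with i | j
    · exact absurd ⟨i, rfl⟩ hk
    · rfl
  have htgt (j : C.ι) : (b (n' j)).tgtBar = some (C.bar j) := by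
    rcases hcases j with ⟨i, hi⟩ | hj
    · rw [hn'_some hi, hb_some hi]; rfl
    · rw [hn'_none hj]; rfl
  have htgt' (k) (hk : k ∉ Set.range n') : (b k).tgtBar = none := by
    rcases k with i | ⟨j, hj⟩
    · rcases h : m i with _ | j
      · rw [hb_none h]; rfl
      · exact absurd ⟨j, hn'_some h⟩ hk
    · exact absurd ⟨j, hn'_none hj⟩ hk
  obtain ⟨E, hE⟩ := LadderBlock.exists_iso_src B b Sum.inl Sum.inl_injective hsrc hsrc'
  obtain ⟨E', hE'⟩ := LadderBlock.exists_iso_tgt C b n' hn' htgt htgt'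
  refine ⟨⟨_, b, ⟨E, E', fun t y => ?_⟩⟩, ⟨Sum.inl, Sum.inl_injective, hsrc, hsrc', hE⟩,
    n', hn', htgt, htgt', hE'⟩
  have key : (E'.hom.app t).comp (f.app t) =
      ((LadderModule.directSum fun k => (b k).toLadder F).hom.app t).comp (E.hom.app t) := by
    refine B.hom_ext fun i hi => ?_
    refine Eq.trans ?_ (congrArg
      ((LadderModule.directSum fun k => (b k).toLadder F).hom.app t) (hE i t)).symm
    refine Eq.trans ?_ (DirectSum.lmap_lof (fun k => ((b k).toLadder F).hom.app t) _ _).symm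
    rcases h : m i with _ | j
    · refine (congrArg (E'.hom.app t) (hnone i t h)).trans ((map_zero _).trans (Eq.symm ?_))
      have : ((b (Sum.inl i)).toLadder F).hom.app t ((b (Sum.inl i)).srcGen F t) = 0 := by
        rw [hb_none h]; rfl
      rw [this, map_zero]
      rfl
    · refine (congrArg (E'.hom.app t) (hsome h t hi)).trans ((hE' j t).trans ?_)
      have : ((b (Sum.inl i)).toLadder F).hom.app t ((b (Sum.inl i)).srcGen F t) =
          (b (Sum.inl i)).tgtGen F t := by
        rw [hb_some h]
        exact LadderBlock.hom_srcGen_R _ t hi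
      rw [this, hn'_some h]
      rfl
  exact LinearMap.congr_fun key y

end PersistenceModule

/-! ### Nestedness bounds, shifts and interleavings -/

namespace PersistenceModule

variable {F : Type u} [Field F] {T : AddSubgroup ℝ}

/-- A nested pair in `B` is one of those in the infimum, so `N` is at most its smaller gap `r`, and
the bound on `δ` becomes `2δ + q < r`. The number `N` is the minimum of two nestednesses, so one
hypothesis serves source and target. -/
theorem BarcodeBasis.nestedGaps_of_lt {V : PersistenceModule.{u, v} F T} (B : V.BarcodeBasis)
    {δ η : T} {q : ℝ} {N : EReal} (hN : N ≤ V.nestedness)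
    (hlt : ((δ : ℝ) : EReal) < ((1 / 2 : ℝ) : EReal) * N - ((q / 2 : ℝ) : EReal))
    (hη : (η : ℝ) = 2 * δ + q) : NestedGaps B.bar η := by
  intro i k hik
  set r : ℝ := min |((B.bar i).birth : ℝ) - (B.bar k).birth|
    |((B.bar i).death : ℝ) - (B.bar k).death| with hr
  have h1 : N ≤ (r : EReal) := hN.trans <|
    iInf_le_of_le (B.bar i) <| iInf_le_of_le (B.bar k) <| iInf_le _ ⟨⟨B, i, rfl⟩, ⟨B, k, rfl⟩, hik⟩
  have h2 : ((δ : ℝ) : EReal) < ((1 / 2 : ℝ) : EReal) * (r : EReal) - ((q / 2 : ℝ) : EReal) := by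
    refine hlt.trans_le (EReal.sub_le_sub (mul_le_mul_of_nonneg_left h1 ?_) le_rfl)
    exact_mod_cast (by norm_num : (0 : ℝ) ≤ 1 / 2)
  have h3 : (δ : ℝ) < 1 / 2 * r - q / 2 := by exact_mod_cast h2
  have h4 : (η : ℝ) < r := by linarith
  have h5 : ((B.bar k).birth : ℝ) < (B.bar i).birth := hik.1
  have h6 : ((B.bar i).death : ℝ) < (B.bar k).death := hik.2
  have h7 := h4.trans_le (min_le_left _ _)
  have h8 := h4.trans_le (min_le_right _ _)
  rw [abs_of_pos (by linarith)] at h7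
  rw [abs_of_neg (by linarith)] at h8
  refine ⟨Subtype.coe_lt_coe.1 ?_, Subtype.coe_lt_coe.1 ?_⟩ <;> push_cast <;> linarith

theorem BarcodeBasis.NestedGaps.shift {ι : Type} {bar : ι → Bar T} {η : T}
    (h : NestedGaps bar η) (α : T) : NestedGaps (fun i => (bar i).shift α) η := by
  intro i k hik
  obtain ⟨h1, h2⟩ := h i k ⟨sub_lt_sub_iff_right α |>.1 hik.1, sub_lt_sub_iff_right α |>.1 hik.2⟩
  refine ⟨?_, ?_⟩
  · change (bar k).birth - α + η < (bar i).birth - α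
    rw [sub_add_eq_add_sub]
    exact sub_lt_sub_right h1 α
  · change (bar i).death - α + η < (bar k).death - α
    rw [sub_add_eq_add_sub]
    exact sub_lt_sub_right h2 α

open BarcodeBasis

/-- Elimination yields some barcode basis of the twice shifted target. Undoing both shifts exhibits
it as the shift of a basis of `Y`, up to a relabelling along which the matching is transported. -/
theorem exists_ladderDecomposition_shift {X : PersistenceModule.{u, v} F T}
    {Y : PersistenceModule.{u, w} F T} {α β η : T} (f : X.Hom ((Y.shift α).shift β))
    (B : X.BarcodeBasis) (C : Y.BarcodeBasis) (hη : 0 ≤ η) (hB : NestedGaps B.bar η)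
    (hC : NestedGaps C.bar η) (hker : KerTrivial f η) (hcoker : CokerTrivial f η) :
    ∃ (D : LadderDecomposition f) (B : X.BarcodeBasis) (C : Y.BarcodeBasis),
      D.IsObtainedIn B ((C.shift α).shift β) := by
  obtain ⟨B', C', m, hm, hnone⟩ := exists_matching f B ((C.shift α).shift β) hη hB
    ((hC.shift α).shift β) hker hcoker
  obtain ⟨D₁, e₁, hbar₁, hgen₁⟩ := C'.exists_unshift
  obtain ⟨D₂, e₂, hbar₂, hgen₂⟩ := D₁.exists_unshift
  let e : D₂.ι ≃ C'.ι := e₂.trans e₁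
  have hbar (j : D₂.ι) : ((D₂.shift α).shift β).bar j = C'.bar (e j) :=
    (congrArg (Bar.shift · β) (hbar₂ j)).trans (hbar₁ (e₂ j))
  have hgen (j : D₂.ι) (t : T) : ((D₂.shift α).shift β).gen j t = C'.gen (e j) t :=
    (gen_shift _ _ _ _).trans ((hgen₂ j (t + β)).trans
      ((gen_shift D₁ β (e₂ j) t).symm.trans (hgen₁ (e₂ j) t)))
  have hmap {i : B'.ι} {j : D₂.ι} (h : (m i).map e.symm = some j) : m i = some (e j) := by
    obtain ⟨k, hk, rfl⟩ := Option.map_eq_some_iff.1 h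
    rw [hk, Equiv.apply_symm_apply]
  obtain ⟨D, hD⟩ := exists_ladderDecomposition f B' ((D₂.shift α).shift β)
    (fun i => (m i).map e.symm) (fun hi hk => hm.inj (hmap hi) (hmap hk))
    (fun {i j} hi => (hbar j).symm ▸ hm.overlaps (hmap hi))
    (fun {i j} hi t ht => (hm.app_gen (hmap hi) t ht).trans (hgen j t).symm)
    (fun i t hi => hnone i t (Option.map_eq_none_iff.1 hi))
  exact ⟨D, B', D₂, hD⟩

/-- The components `V_t → W_{t + δ}` of a morphism `V → W(δ)`. -/
def Hom.up {V : PersistenceModule.{u, v} F T} {W : PersistenceModule.{u, w} F T} {δ : T}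
    (Φ : V.Hom (W.shift δ)) (t : T) : V.obj t →ₗ[F] W.obj (t + δ) :=
  Φ.app t

theorem Hom.up_map {V : PersistenceModule.{u, v} F T} {W : PersistenceModule.{u, w} F T}
    {δ : T} (Φ : V.Hom (W.shift δ)) {s t : T} (h : s ≤ t) (y : V.obj s) :
    Φ.up t (V.map h y) = W.map (add_le_add_left h δ) (Φ.up s y) :=
  Φ.naturality h y

section Interleaving

theorem QSplitting.incl_injective {V : PersistenceModule.{u, v} F T} {q : ℝ} (S : V.QSplitting q)
    (t : T) : Function.Injective (S.incl.app t) :=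
  Function.LeftInverse.injective (S.pr_incl t)

variable {V : PersistenceModule.{u, v} F T} {W : PersistenceModule.{u, w} F T}
  {S₀ : Finset T} {δ : T} {hδ : 0 ≤ δ} {Φ : V.Hom (W.shift δ)} {Ψ : W.Hom (V.shift δ)}
  {q : ℝ} {κ : T}

theorem IsInterleaving.up_up (hΦΨ : IsInterleaving hδ Φ Ψ) (t : T) (y : V.obj t) :
    Ψ.up (t + δ) (Φ.up t y) =
      V.map ((le_add_of_nonneg_right hδ).trans (le_add_of_nonneg_right hδ) : t ≤ t + δ + δ) y :=
  hΦΨ.1 t y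

theorem IsInterleaving.up_up' (hΦΨ : IsInterleaving hδ Φ Ψ) (t : T) (y : W.obj t) :
    Φ.up (t + δ) (Ψ.up t y) =
      W.map ((le_add_of_nonneg_right hδ).trans (le_add_of_nonneg_right hδ) : t ≤ t + δ + δ) y :=
  hΦΨ.2 t y

/-- A further shift by `κ` completes `[q]`, after which the projection to the coarse part loses
nothing; then `Ψ` turns `Φ` into `[2δ]`. -/
theorem kerTrivial_toCoarse_comp (hΦΨ : IsInterleaving hδ Φ Ψ) (hκ : 0 ≤ κ) (hq : (κ : ℝ) = q / 2)
    (SW : W.QSplitting q) (hW : W.HasCriticalTimes S₀) :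
    KerTrivial (((SW.toCoarse hκ hq).shift δ).comp Φ) (δ + κ + κ + δ) := by
  intro t u h hu y h0
  change SW.coarse.map (le_add_of_nonneg_right hκ) (SW.pr.app (t + δ) (Φ.up t y)) = 0 at h0
  have h1 : t + δ + κ ≤ t + δ + κ + κ := le_add_of_nonneg_right hκ
  have h2 := congrArg (fun z => SW.incl.app _ (SW.coarse.map h1 z)) h0
  simp only [SW.coarse.map_map, SW.incl.naturality, map_zero] at h2
  rw [SW.map_incl_pr hW _ (by push_cast; linarith)] at h2
  have h3 := congrArg (Ψ.up _) h2
  rw [map_zero, Ψ.up_map, hΦΨ.up_up, V.map_map] at h3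
  have h4 : t + δ + κ + κ + δ ≤ u := by rw [hu]; simp only [add_assoc, le_refl]
  have h5 := congrArg (V.map h4) h3
  rw [V.map_map] at h5
  exact h5.trans (map_zero _)

/-- The preimage is `Ψ` of the included vector, pushed forward. Projection after inclusion is the
identity, so no cancellation of fine bars is needed. -/
theorem cokerTrivial_toCoarse_comp (hΦΨ : IsInterleaving hδ Φ Ψ) (hκ : 0 ≤ κ)
    (hq : (κ : ℝ) = q / 2) (SW : W.QSplitting q) :
    CokerTrivial (((SW.toCoarse hκ hq).shift δ).comp Φ) (δ + κ + κ + δ) := by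
  intro t u h hu (y : SW.coarse.obj (t + δ + κ))
  have h1 : t + δ + κ + δ ≤ u := by subst hu; grind
  refine ⟨V.map h1 (Ψ.up (t + δ + κ) (SW.incl.app (t + δ + κ) y)), ?_⟩
  change SW.coarse.map (le_add_of_nonneg_right hκ) (SW.pr.app (u + δ) (Φ.up u _)) =
    SW.coarse.map (add_le_add_left (add_le_add_left h _) _) y
  rw [Φ.up_map, hΦΨ.up_up', W.map_map, SW.pr.naturality, SW.pr_incl, SW.coarse.map_map]

theorem kerTrivial_comp_ofCoarse (hΦΨ : IsInterleaving hδ Φ Ψ) (hκ : 0 ≤ κ) (hq : (κ : ℝ) = q / 2)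
    (SV : V.QSplitting q) :
    KerTrivial ((Φ.shift κ).comp (SV.ofCoarse hκ hq)) (δ + κ + κ + δ) := by
  intro t u h hu y h0
  change Φ.up (t + κ) (SV.incl.app (t + κ) (SV.coarse.map (le_add_of_nonneg_right hκ) y)) = 0 at h0
  have h1 := congrArg (Ψ.up _) h0
  rw [map_zero, hΦΨ.up_up, ← SV.incl.naturality, SV.coarse.map_map] at h1
  have h2 := SV.incl_injective _ (h1.trans (map_zero _).symm)
  have h3 : t + κ + δ + δ ≤ u := by subst hu; grind
  have h4 := congrArg (SV.coarse.map h3) h2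
  rw [SV.coarse.map_map] at h4
  exact h4.trans (map_zero _)

/-- The preimage is the coarse part of `Ψ y`, pushed forward by `κ`. The `κ` in `ofCoarse` brings
the total to `q`, which makes the fine part of `Ψ y` irrelevant. -/
theorem cokerTrivial_comp_ofCoarse (hΦΨ : IsInterleaving hδ Φ Ψ) (hκ : 0 ≤ κ)
    (hq : (κ : ℝ) = q / 2) (SV : V.QSplitting q) (hV : V.HasCriticalTimes S₀) :
    CokerTrivial ((Φ.shift κ).comp (SV.ofCoarse hκ hq)) (δ + κ + κ + δ) := by
  intro t u h hu (y : W.obj (t + κ + δ))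
  have h1 : t + κ + δ + δ ≤ u := by subst hu; grind
  refine ⟨SV.coarse.map h1 (SV.pr.app _ (Ψ.up (t + κ + δ) y)), ?_⟩
  change Φ.up (u + κ) (SV.incl.app (u + κ) (SV.coarse.map (le_add_of_nonneg_right hκ) _)) =
    W.map (add_le_add_left (add_le_add_left h _) _) y
  rw [SV.coarse.map_map, SV.incl.naturality,
    SV.map_incl_pr hV _ (by subst hu; push_cast; linarith), Φ.up_map, hΦΨ.up_up', W.map_map]

theorem kerTrivial_comp_incl (hΦΨ : IsInterleaving hδ Φ Ψ) (hκ : 0 ≤ κ) (hq : (κ : ℝ) = q / 2)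
    (SV : V.QSplitting q) (SW : W.QSplitting q) (hW : W.HasCriticalTimes S₀) :
    KerTrivial ((((SW.toCoarse hκ hq).shift δ).comp Φ).comp SV.incl) (δ + κ + κ + δ) := by
  intro t u h hu y h0
  refine SV.incl_injective u ?_
  rw [SV.incl.naturality, map_zero]
  exact kerTrivial_toCoarse_comp hΦΨ hκ hq SW hW t u h hu _ h0

theorem cokerTrivial_comp_incl (hΦΨ : IsInterleaving hδ Φ Ψ) (hκ : 0 ≤ κ) (hq : (κ : ℝ) = q / 2)
    (SV : V.QSplitting q) (SW : W.QSplitting q) (hV : V.HasCriticalTimes S₀) :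
    CokerTrivial ((((SW.toCoarse hκ hq).shift δ).comp Φ).comp SV.incl) (δ + κ + κ + δ) := by
  intro t u h hu (y : SW.coarse.obj (t + δ + κ))
  have h1 : t + δ + κ + δ ≤ u := by subst hu; grind
  have h2 : t + δ + κ + δ ≤ t + δ + κ + δ + κ + κ :=
    (le_add_of_nonneg_right hκ).trans (le_add_of_nonneg_right hκ)
  have h3 : t + δ + κ + δ + κ + κ + δ ≤ u + δ + κ := by subst hu; grind
  set z := Ψ.up (t + δ + κ) (SW.incl.app (t + δ + κ) y) with hz
  -- Replacing `z` by its coarse part in `V` costs a shift by `q`, but half of it is performed only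
  -- after `Φ`, on the side of `W`. Naturality of `Φ` moves it back to `V`.
  have hmap : ∀ x : V.obj (t + δ + κ + δ), W.map ((add_le_add_left h2 δ).trans h3) (Φ.up _ x) =
      W.map h3 (Φ.up _ (V.map h2 x)) := fun x => by
    rw [Φ.up_map, W.map_map]
  refine ⟨SV.coarse.map h1 (SV.pr.app _ z), ?_⟩
  change SW.coarse.map (le_add_of_nonneg_right hκ)
    (SW.pr.app (u + δ) (Φ.up u (SV.incl.app u _))) =
    SW.coarse.map (add_le_add_left (add_le_add_left h _) _) y
  rw [SV.incl.naturality, Φ.up_map, ← SW.pr.naturality, W.map_map, hmap,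
    SV.map_incl_pr hV h2 (by push_cast; linarith), ← hmap, hz, hΦΨ.up_up', W.map_map, SW.pr.naturality,
    SW.pr_incl]

end Interleaving

end PersistenceModule

theorem mainTheorem6 {F : Type u} [Field F] {T : AddSubgroup ℝ}
    (V : PersistenceModule.{u, v} F T) (W : PersistenceModule.{u, w} F T)
    (hV : V.IsFinitelyIndexed) (hW : W.IsFinitelyIndexed)
    (δ : T) (hδ : 0 ≤ δ) (Φ : V.Hom (W.shift δ))
    (hΦ : ∃ Ψ : W.Hom (V.shift δ), PersistenceModule.IsInterleaving hδ Φ Ψ)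
    (q : ℝ) (κ : T) (hκ : 0 ≤ κ) (hq : (κ : ℝ) = q / 2)
    (SV : V.QSplitting q) (SW : W.QSplitting q) :
    ((((δ : ℝ) : EReal) <
        ((1 / 2 : ℝ) : EReal) * min V.nestedness SW.coarse.nestedness - ((q / 2 : ℝ) : EReal)) →
      ∃ (D : LadderDecomposition (((SW.toCoarse hκ hq).shift δ).comp Φ))
        (B : V.BarcodeBasis) (C : SW.coarse.BarcodeBasis),
        D.IsObtainedIn B ((C.shift κ).shift δ) ∧ C.ExtendsAlong SW.incl) ∧
    ((((δ : ℝ) : EReal) <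
        ((1 / 2 : ℝ) : EReal) * min SV.coarse.nestedness W.nestedness - ((q / 2 : ℝ) : EReal)) →
      ∃ (D : LadderDecomposition ((Φ.shift κ).comp (SV.ofCoarse hκ hq)))
        (B : SV.coarse.BarcodeBasis) (C : W.BarcodeBasis),
        D.IsObtainedIn B ((C.shift δ).shift κ) ∧ B.ExtendsAlong SV.incl) ∧
    ((((δ : ℝ) : EReal) <
        ((1 / 2 : ℝ) : EReal) * min SV.coarse.nestedness SW.coarse.nestedness
          - ((q / 2 : ℝ) : EReal)) →
      ∃ (D : LadderDecomposition ((((SW.toCoarse hκ hq).shift δ).comp Φ).comp SV.incl))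
        (B : SV.coarse.BarcodeBasis) (C : SW.coarse.BarcodeBasis),
        D.IsObtainedIn B ((C.shift κ).shift δ) ∧
          B.ExtendsAlong SV.incl ∧ C.ExtendsAlong SW.incl) := by
  obtain ⟨Ψ, hΦΨ⟩ := hΦ
  obtain ⟨hV₁, S₀, hV₂⟩ := hV
  obtain ⟨hW₁, S₁, hW₂⟩ := hW
  have hV : V.HasCriticalTimes S₀ := ⟨hV₁, hV₂⟩
  have hW : W.HasCriticalTimes S₁ := ⟨hW₁, hW₂⟩
  obtain ⟨B⟩ := hV.nonempty_barcodeBasis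
  obtain ⟨C⟩ := hW.nonempty_barcodeBasis
  obtain ⟨B'⟩ := SV.nonempty_basis_coarse hV
  obtain ⟨C'⟩ := SW.nonempty_basis_coarse hW
  -- η = 2δ + q, with `q = κ + κ`.
  have hη : 0 ≤ δ + κ + κ + δ := by positivity
  have hη' : ((δ + κ + κ + δ : T) : ℝ) = 2 * δ + q := by push_cast; linarith
  refine ⟨fun h => ?_, fun h => ?_, fun h => ?_⟩
  · obtain ⟨D, B₁, C₁, hD⟩ := exists_ladderDecomposition_shift _ B C' hη
      (B.nestedGaps_of_lt (min_le_left _ _) h hη') (C'.nestedGaps_of_lt (min_le_right _ _) h hη')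
      (kerTrivial_toCoarse_comp hΦΨ hκ hq SW hW) (cokerTrivial_toCoarse_comp hΦΨ hκ hq SW)
    exact ⟨D, B₁, C₁, hD, SW.extendsAlong_incl hW C₁⟩
  · obtain ⟨D, B₁, C₁, hD⟩ := exists_ladderDecomposition_shift _ B' C hη
      (B'.nestedGaps_of_lt (min_le_left _ _) h hη') (C.nestedGaps_of_lt (min_le_right _ _) h hη')
      (kerTrivial_comp_ofCoarse hΦΨ hκ hq SV) (cokerTrivial_comp_ofCoarse hΦΨ hκ hq SV hV)
    exact ⟨D, B₁, C₁, hD, SV.extendsAlong_incl hV B₁⟩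
  · obtain ⟨D, B₁, C₁, hD⟩ := exists_ladderDecomposition_shift _ B' C' hη
      (B'.nestedGaps_of_lt (min_le_left _ _) h hη') (C'.nestedGaps_of_lt (min_le_right _ _) h hη')
      (kerTrivial_comp_incl hΦΨ hκ hq SV SW hW) (cokerTrivial_comp_incl hΦΨ hκ hq SV SW hV)
    exact ⟨D, B₁, C₁, hD, SV.extendsAlong_incl hV B₁, SW.extendsAlong_incl hW C₁⟩
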